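/- **Definitions.** Let $\Sigma$ be a finite alphabet and $\mathcal X$ a finite set of variables. A (copyless) *substitution* is a map $\sigma:\mathcal X\to(\mathcal X\cup\Sigma)^*$ such that no variable occurs twice in the image of a variable and no variable occurs in the images of two distinct variables; it extends to a morphism of $(\mathcal X\cup\Sigma)^*$ fixing the letters, and $\sigma\circ\tau$ applies $\tau$ first, then $\sigma$. Let $\sigma_\varepsilon$ map every variable to the empty word. A *streaming string transducer* (SST) $T$ over $\Sigma$ consists of a finite automaton over $\Sigma$ (states $Q$, initial states $I$, transitions $\Delta\subseteq Q\times\Sigma\times Q$, final states $F$; possibly nondeterministic), a finite set $\mathcal X$ of variables with an output variable $O\in\mathcal X$, a substitution $\kappa(e)$ for every $e\in\Delta$, and a final substitution $\kappa_F(q)$ for every $q\in Q$. To an accepting run with transitions $e_1,\dots,e_n$, final state $q$ and input $u$ (so $|u|=n$) belongs the sequence of substitutions $\lambda=\kappa(e_1)\cdots\kappa(e_n)\,\kappa_F(q)$; let $L(T)$ be the set of all such pairs $(u,\lambda)$. The *output* of $\lambda=\sigma_1\cdots\sigma_m$ is $\mathrm{out}(\lambda)=(\sigma_\varepsilon\circ\sigma_1\circ\cdots\circ\sigma_m)(O)\in\Sigma^*$,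 and $R(T)=\{(u,\mathrm{out}(\lambda)) : (u,\lambda)\in L(T)\}$. $T$ is *functional* if $R(T)$ is a (partial) function. Write $T_1\subseteq T_2$ for $R(T_1)\subseteq R(T_2)$ and $T_1\equiv T_2$ for $R(T_1)=R(T_2)$. The *origin* of a position of $\mathrm{out}(\lambda)$ is the index $t\in\{1,\dots,|\lambda|\}$ of the substitution of $\lambda$ that produces the letter at that position, and $\mathrm{weight}_{j,t}(\lambda)$ is the number of positions $i\le\min(j,|\mathrm{out}(\lambda)|)$ of $\mathrm{out}(\lambda)$ with origin at most $t$. For $\ell\ge1$, the *$\ell$-factorization* of a word $w$ is obtained from left to right, each factor being the longest prefix of the remaining word whose primitive root has length at most $\ell$ (the primitive root of $v$ is the shortest word $r$ with $v=r^p$ for some $p\ge1$); $\mathrm{cut}_\ell(w)$ is the set of end positions of the factors. For $\lambda,\mu$ with $|\lambda|=|\mu|$ and $\mathrm{out}(\lambda)=\mathrm{out}(\mu)$ let $$\mathrm{delay}_\ell(\lambda,\mu)=\max_{j\in \mathrm{cut}_\ell(\mathrm{out}(\lambda))}\ \max_{1\le t\le|\lambda|}\ \bigl|\mathrm{weight}_{j,t}(\lambda)-\mathrm{weight}_{j,t}(\mu)\bigr|,$$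 where the maximum of the empty set is $0$. For SSTs $T_1,T_2$ over $\Sigma$, $T_1$ is *$(k,\ell)$-included* in $T_2$, written $T_1\subseteq_{k,\ell}T_2$, if for every $(u,\lambda)\in L(T_1)$ there is $(u,\mu)\in L(T_2)$ with $|\lambda|=|\mu|$, $\mathrm{out}(\lambda)=\mathrm{out}(\mu)$ and $\mathrm{delay}_\ell(\lambda,\mu)\le k$; and $T_1\equiv_{k,\ell}T_2$ means $T_1\subseteq_{k,\ell}T_2$ and $T_2\subseteq_{k,\ell}T_1$. **Theorem.** There are computable functions that map (finite descriptions of) any two functional SSTs $T_1,T_2$ over a common finite alphabet to integers $k\ge0$ and $\ell\ge1$ such that $$T_1\subseteq T_2\iff T_1\subseteq_{k,\ell}T_2 .$$ Likewise, there are computable functions that map any two functional SSTs $T_1,T_2$ over a common finite alphabet to integers $k\ge0$ and $\ell\ge1$ such that $$T_1\equiv T_2\iff T_1\equiv_{k,\ell}T_2 .$$ -/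

import Mathlib

namespace SSTDelay

/-! ### Substitutions -/

/-- Maps from variables to words over variables (`Sum.inl`) and letters (`Sum.inr`). -/
abbrev Subst (X A : Type*) := X → List (X ⊕ A)

namespace Subst

variable {X A : Type*}

/-- The sequence of variables that occur in a word over variables and letters. -/
def varsOf (w : List (X ⊕ A)) : List X := w.filterMap Sum.getLeft?

/-- The sequence of letters that occur in a word over variables and letters. -/
def lettersOf (w : List (X ⊕ A)) : List A := w.filterMap Sum.getRight?

/-- No variable occurs twice in the image of a variable, and no variable occurs in the images
of two distinct variables. -/
structure Copyless (σ : Subst X A) : Prop where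
  nodup : ∀ x, (varsOf (σ x)).Nodup
  disjoint : ∀ x y, x ≠ y → (varsOf (σ x)).Disjoint (varsOf (σ y))

/-- The extension of a substitution to a morphism that fixes the letters. -/
def ext (σ : Subst X A) (w : List (X ⊕ A)) : List (X ⊕ A) :=
  w.flatMap (Sum.elim σ fun a => [Sum.inr a])

/-- `comp σ τ` is `σ ∘ τ`: first `τ`, then the extension of `σ`. -/
def comp (σ τ : Subst X A) : Subst X A := fun x => ext σ (τ x)

/-- The identity substitution. -/
def idSubst (X A : Type*) : Subst X A := fun x => [Sum.inl x]

/-- The substitution that maps every variable to the empty word. -/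
def epsSubst (X A : Type*) : Subst X A := fun _ => []

/-- `σ₁ ∘ σ₂ ∘ ⋯ ∘ σₙ`. -/
def compList (ls : List (Subst X A)) : Subst X A := ls.foldr comp (idSubst X A)

/-- The substitution obtained by replacing each letter with the number `t`. -/
def relabel (t : ℕ) (σ : Subst X A) : Subst X ℕ :=
  fun x => (σ x).map (Sum.map id fun _ => t)

end Subst

section Delay

variable {X X₁ X₂ A : Type*}

/-- The output `(σ_ε ∘ σ₁ ∘ ⋯ ∘ σₙ)(O)` of a sequence of substitutions; after the application
of `σ_ε` the word holds letters only, and `lettersOf` reads it as a word of letters. -/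
def out (O : X) (ls : List (Subst X A)) : List A :=
  Subst.lettersOf (Subst.comp (Subst.epsSubst X A) (Subst.compList ls) O)

/-- The origin function as a word: the letter at a position of `origins O ls` is the (one-based)
index of the substitution of `ls` that produces the letter at that position of `out O ls`. -/
def origins (O : X) (ls : List (Subst X A)) : List ℕ :=
  out O (ls.mapIdx fun i σ => Subst.relabel (i + 1) σ)

/-- The number of positions among the first `j` positions of the output whose origin is at
most `t`. -/
def weight (O : X) (j t : ℕ) (ls : List (Subst X A)) : ℕ :=
  ((origins O ls).take j).countP fun i => decide (i ≤ t)

/-- `|weight_{j,t}(λ) - weight_{j,t}(μ)|`. -/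
def diff (O₁ : X₁) (O₂ : X₂) (j t : ℕ) (ls : List (Subst X₁ A)) (ms : List (Subst X₂ A)) : ℕ :=
  ((weight O₁ j t ls : ℤ) - (weight O₂ j t ms : ℤ)).natAbs

/-- The maximum of `diff_{j,t}(λ,μ)` over `1 ≤ t ≤ |λ|`. -/
def maxDiff (O₁ : X₁) (O₂ : X₂) (j : ℕ) (ls : List (Subst X₁ A)) (ms : List (Subst X₂ A)) : ℕ :=
  (Finset.Icc 1 ls.length).sup fun t => diff O₁ O₂ j t ls ms

/-- The word `w ^ k`. -/
def wordPow (w : List A) (k : ℕ) : List A := (List.replicate k w).flatten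

/-- The length of the primitive root of `u`, that is, of the shortest word `w` such that
`u = w ^ k` for some positive `k` (there is one: `w = u`, `k = 1`). -/
noncomputable def rootLength (u : List A) : ℕ :=
  sInf {n | ∃ (w : List A) (k : ℕ), w.length = n ∧ 0 < k ∧ u = wordPow w k}

open Classical in
/-- The length of the longest prefix of `u` whose primitive root has length at most `l`. -/
noncomputable def firstFactorLength (l : ℕ) (u : List A) : ℕ :=
  Nat.findGreatest (fun n => rootLength (u.take n) ≤ l) u.length

open Classical in
/-- The `l`-factorization of `u` (for `0 < l`): the first factor is the longest prefix of `u`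
whose primitive root has length at most `l`, and the rest of `u` is factorized in the same way.
For `0 < l` the first factor of a nonempty word is nonempty. -/
noncomputable def factors (l : ℕ) (u : List A) : List (List A) :=
  if _h : u = [] ∨ firstFactorLength l u = 0 then []
  else u.take (firstFactorLength l u) :: factors l (u.drop (firstFactorLength l u))
termination_by u.length
decreasing_by
  have h₁ : 0 < u.length := List.length_pos_iff.mpr fun e => _h (Or.inl e)
  have h₂ : firstFactorLength l u ≠ 0 := fun e => _h (Or.inr e)
  rw [List.length_drop]
  omega

/-- The set of the end positions of the factors of the `l`-factorization. -/
noncomputable def cuts (l : ℕ) (u : List A) : Finset ℕ :=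
  (Finset.Icc 1 (factors l u).length).image fun i => ((factors l u).take i).flatten.length

/-- The `l`-delay; meant for sequences of the same length with the same output. -/
noncomputable def delay (O₁ : X₁) (O₂ : X₂) (l : ℕ)
    (ls : List (Subst X₁ A)) (ms : List (Subst X₂ A)) : ℕ :=
  (cuts l (out O₁ ls)).sup fun j => maxDiff O₁ O₂ j ls ms

/-- The `(k,l)`-delay resynchronizer: pairs of sequences, of substitutions from `S₁` and
from `S₂`, that have the same length, the same output, and `l`-delay at most `k`. Neither the
output nor the origins of a sequence involve variables other than its own, so that
the two sets of variables need not be merged. -/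
def delayResync (O₁ : X₁) (O₂ : X₂) (k l : ℕ) (S₁ : Set (Subst X₁ A)) (S₂ : Set (Subst X₂ A)) :
    Set (List (Subst X₁ A) × List (Subst X₂ A)) :=
  {p | (∀ σ ∈ p.1, σ ∈ S₁) ∧ (∀ τ ∈ p.2, τ ∈ S₂) ∧ p.1.length = p.2.length ∧
    out O₁ p.1 = out O₂ p.2 ∧ delay O₁ O₂ l p.1 p.2 ≤ k}

end Delay

/-! ### Streaming string transducers -/

/-- A (nondeterministic, copyless) streaming string transducer with alphabet `A`, set of
states `Q` and set of variables `X`. -/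
structure SST (A Q X : Type*) where
  /-- the initial states -/
  start : Finset Q
  /-- the transitions -/
  trans : Finset (Q × A × Q)
  /-- the final states -/
  accept : Finset Q
  /-- the output variable -/
  O : X
  /-- the substitutions of the transitions -/
  κ : {e : Q × A × Q // e ∈ trans} → Subst X A
  /-- the final substitutions -/
  κF : Q → Subst X A
  copyless : ∀ e, (κ e).Copyless
  copylessF : ∀ q, (κF q).Copyless

namespace SST

variable {A Q X : Type*}

/-- `T.Run p u ls q`: there is a run of `T` from `p` to `q` with input `u` whose transitions carry
the sequence of substitutions `ls` (the final substitution is not included). -/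
inductive Run (T : SST A Q X) : Q → List A → List (Subst X A) → Q → Prop
  | nil (p : Q) : Run T p [] [] p
  | cons {p q r : Q} {a : A} {u : List A} {ls : List (Subst X A)} (h : (p, a, q) ∈ T.trans)
      (hr : Run T q u ls r) : Run T p (a :: u) (T.κ ⟨(p, a, q), h⟩ :: ls) r

/-- The pairs of the input and the sequence of substitutions, the final substitution included, of
an accepting run. -/
def lang (T : SST A Q X) : Set (List A × List (Subst X A)) :=
  {p | ∃ q₀ ∈ T.start, ∃ q ∈ T.accept, ∃ ls, T.Run q₀ p.1 ls q ∧ p.2 = ls ++ [T.κF q]}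

/-- The transduction recognized by `T`. -/
def rel (T : SST A Q X) : Set (List A × List A) :=
  {p | ∃ ls, (p.1, ls) ∈ T.lang ∧ p.2 = out T.O ls}

/-- The transduction recognized by `T` is a (partial) function. -/
def Functional (T : SST A Q X) : Prop :=
  ∀ u v w, (u, v) ∈ T.rel → (u, w) ∈ T.rel → v = w

/-- The substitutions that occur in `T`. -/
def substs (T : SST A Q X) : Set (Subst X A) := Set.range T.κ ∪ Set.range T.κF

/-- `T₁` is `(k,l)`-included in `T₂`. -/
def IncludedUpTo {Q₁ X₁ Q₂ X₂ : Type*} (k l : ℕ) (T₁ : SST A Q₁ X₁) (T₂ : SST A Q₂ X₂) : Prop :=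
  ∀ u ls, (u, ls) ∈ T₁.lang → ∃ ms, (u, ms) ∈ T₂.lang ∧
    (ls, ms) ∈ delayResync T₁.O T₂.O k l T₁.substs T₂.substs

/-- `T₁` is `(k,l)`-equivalent to `T₂`. -/
def EquivUpTo {Q₁ X₁ Q₂ X₂ : Type*} (k l : ℕ) (T₁ : SST A Q₁ X₁) (T₂ : SST A Q₂ X₂) : Prop :=
  IncludedUpTo k l T₁ T₂ ∧ IncludedUpTo k l T₂ T₁

end SST

/-! ### Transducers as inputs of algorithms

A transducer whose letters, states and variables are numbered is written out as a finite
list of natural numbers. -/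

/-- Substitutions as data: the images of the variables, in order. -/
abbrev SubstCode := List (List (ℕ ⊕ ℕ))

/-- Transducers as data: the numbers of letters, of states and of variables; the initial states;
the transitions with their substitutions; the final states; the output variable; the final
substitutions of the states, in order. -/
abbrev SSTCode :=
  (ℕ × ℕ × ℕ) × List ℕ × List ((ℕ × ℕ × ℕ) × SubstCode) × List ℕ × ℕ × List SubstCode

/-- The description of a substitution. -/
def Subst.code {a x : ℕ} (σ : Subst (Fin x) (Fin a)) : SubstCode :=
  List.ofFn fun i => (σ i).map (Sum.map Fin.val Fin.val)

/-- The description of a transducer. -/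
def SST.code {a n x : ℕ} (T : SST (Fin a) (Fin n) (Fin x)) : SSTCode :=
  ((a, n, x),
    ((List.finRange n).filter (· ∈ T.start)).map Fin.val,
    ((List.finRange n).product ((List.finRange a).product (List.finRange n))).filterMap
      (fun e => if h : e ∈ T.trans
        then some ((e.1.val, e.2.1.val, e.2.2.val), Subst.code (T.κ ⟨e, h⟩)) else none),
    ((List.finRange n).filter (· ∈ T.accept)).map Fin.val,
    T.O.val,
    List.ofFn fun q => Subst.code (T.κF q))

end SSTDelay

/-!
Suppose that `T₁ ⊆ T₂` and that `T₂` is functional. Then *any* two accepting runs of `T₁` and `T₂`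
on the same input have the same output, and the claim is that this alone bounds the delay of such
runs; the converse direction is immediate.

Let `j` be a cut of the output `w` and `t` a time. A cut is not far inside of a factor of `w` with
a period of length at most `l` (`not_repetitive_of_mem_cuts`), so the window of `w` from `j - 2 *
l` to `j + l` is not a factor of a power `vᵐ` with `|v| ≤ l`, or it reaches an end of `w`. If `t`
is large, there is a long interval of times before `t` at which neither run produces a letter of
the window. By a Ramsey argument for the states and the flow of variables (`exists_loop`), the
interval contains consecutive segments `L₁`, `L₂`, `L₃` of bounded length with the same idempotent
flow of variables in both transducers, where `L₂` is a loop. Repeating `L₂` pumps blocks `p vⁿ⁻¹ q`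
in either output (`Fam`, `fam_out`), with `|v| ≤ l`, and the window moves to the right at a
constant speed in either one. The outputs are always equal. Were the two speeds different, then the
window at its place in the slower output would be, for large `n`, far inside of a pumped block of
the faster one, and hence a factor of a power of some `v` (`Fam.repetitive_of_slope_lt`). So the
speeds are equal (for a window at an end of `w` this is clear, since the whole outputs have equal
lengths), and the removal of `L₂` deletes the same number of letters, all produced before `t`, in
front of the window in both outputs. This changes neither the window nor the difference of the
weights at `j`. After removing loops as long as possible, `t` is bounded, and so are both weights
(`weight_diff_le`).

All bounds are explicit primitive recursive functions of the code of the pair of transducers, which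
bounds the numbers of states and variables and the sizes of the substitutions (`bounds_of_code`).
-/

namespace SSTDelay

/-! ### Evaluation of substitutions on contents of variables -/

section Eval

variable {X A B : Type*}

/-- The word obtained from `w` by inserting the contents `P` of the variables. -/
def ev (P : X → List A) (w : List (X ⊕ A)) : List A :=
  w.flatMap (Sum.elim P fun a => [a])

/-- The contents of the variables after the update `σ`, if they are `P` before it. -/
def act (P : X → List A) (σ : Subst X A) : X → List A := fun x => ev P (σ x)

@[simp] theorem ev_nil (P : X → List A) : ev P [] = [] := rfl

@[simp] theorem ev_cons_inl (P : X → List A) (x : X) (w : List (X ⊕ A)) :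
    ev P (Sum.inl x :: w) = P x ++ ev P w := by simp [ev]

@[simp] theorem ev_cons_inr (P : X → List A) (a : A) (w : List (X ⊕ A)) :
    ev P (Sum.inr a :: w) = a :: ev P w := by simp [ev]

@[simp] theorem ev_append (P : X → List A) (w w' : List (X ⊕ A)) :
    ev P (w ++ w') = ev P w ++ ev P w' := by simp [ev]

open Subst

@[simp] theorem varsOf_cons_inl (x : X) (w : List (X ⊕ A)) :
    varsOf (Sum.inl x :: w) = x :: varsOf w := by simp [varsOf]

@[simp] theorem varsOf_cons_inr (a : A) (w : List (X ⊕ A)) :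
    varsOf (Sum.inr a :: w) = varsOf w := by simp [varsOf, List.filterMap_cons]

@[simp] theorem varsOf_append (w w' : List (X ⊕ A)) :
    varsOf (w ++ w') = varsOf w ++ varsOf w' := by simp [varsOf]

@[simp] theorem lettersOf_cons_inl (x : X) (w : List (X ⊕ A)) :
    lettersOf (Sum.inl x :: w) = lettersOf w := by simp [lettersOf, List.filterMap_cons]

@[simp] theorem lettersOf_cons_inr (a : A) (w : List (X ⊕ A)) :
    lettersOf (Sum.inr a :: w) = a :: lettersOf w := by simp [lettersOf]

@[simp] theorem lettersOf_append (w w' : List (X ⊕ A)) :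
    lettersOf (w ++ w') = lettersOf w ++ lettersOf w' := by simp [lettersOf]

@[simp] theorem varsOf_nil : varsOf ([] : List (X ⊕ A)) = [] := rfl

@[simp] theorem lettersOf_nil : lettersOf ([] : List (X ⊕ A)) = [] := rfl

theorem ev_ext (P : X → List A) (σ : Subst X A) (w : List (X ⊕ A)) :
    ev P (ext σ w) = ev (act P σ) w := by
  induction w with
  | nil => rfl
  | cons a w ih => cases a <;> simp_all [ext, act]

theorem lettersOf_ext_eps (w : List (X ⊕ A)) :
    lettersOf (ext (epsSubst X A) w) = ev (fun _ => []) w := by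
  induction w with
  | nil => rfl
  | cons a w ih => cases a <;> simp_all [ext, epsSubst]

/-- Contents are updated in the order of the sequence, although the composition
`σ₁ ∘ ⋯ ∘ σₙ` applies `σₙ` first. -/
theorem foldl_act (P : X → List A) (ls : List (Subst X A)) (x : X) :
    ls.foldl act P x = ev P (compList ls x) := by
  induction ls generalizing P with
  | nil => simp [compList, idSubst]
  | cons σ ls ih =>
    rw [List.foldl_cons, ih, ← ev_ext]
    rfl

theorem out_eq_foldl (O : X) (ls : List (Subst X A)) :
    out O ls = ls.foldl act (fun _ => []) O := by
  rw [foldl_act, out, comp, lettersOf_ext_eps]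

/-- The values of a word under two contents agree if they agree on its variables. -/
theorem ev_congr {P P' : X → List A} {w : List (X ⊕ A)} (h : ∀ y ∈ varsOf w, P y = P' y) :
    ev P w = ev P' w := by
  induction w with
  | nil => rfl
  | cons a w ih => cases a <;> simp_all

theorem ev_eq_lettersOf (P : X → List A) {w : List (X ⊕ A)} (h : varsOf w = []) :
    ev P w = lettersOf w := by
  induction w with
  | nil => rfl
  | cons a w ih => cases a <;> simp_all

theorem mem_ev {P : X → List A} {w : List (X ⊕ A)} {a : A} (h : a ∈ ev P w) :
    (∃ y ∈ varsOf w, a ∈ P y) ∨ a ∈ lettersOf w := by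
  induction w with
  | nil => simp at h
  | cons b w ih => cases b <;> simp_all <;> grind

theorem countP_ev (p : A → Bool) (P : X → List A) (w : List (X ⊕ A)) :
    (ev P w).countP p =
      (lettersOf w).countP p + ((varsOf w).map fun y => (P y).countP p).sum := by
  induction w with
  | nil => rfl
  | cons a w ih =>
    cases a
    · simp [ih]; omega
    · simp [ih, List.countP_cons]; omega

/-- The letters of a substitution, renamed by `f`. -/
def mapLetters (f : A → B) (σ : Subst X A) : Subst X B := fun x => (σ x).map (Sum.map id f)

theorem varsOf_map (f : A → B) (w : List (X ⊕ A)) :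
    varsOf (w.map (Sum.map id f)) = varsOf w := by
  induction w with
  | nil => rfl
  | cons a w ih => cases a <;> simp_all

theorem lettersOf_map (f : A → B) (w : List (X ⊕ A)) :
    lettersOf (w.map (Sum.map id f)) = (lettersOf w).map f := by
  induction w with
  | nil => rfl
  | cons a w ih => cases a <;> simp_all

theorem ev_map (f : A → B) (P : X → List A) (w : List (X ⊕ A)) :
    ev (fun x => (P x).map f) (w.map (Sum.map id f)) = (ev P w).map f := by
  induction w with
  | nil => rfl
  | cons a w ih => cases a <;> simp_all

theorem out_map (f : A → B) (O : X) (ls : List (Subst X A)) :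
    out O (ls.map (mapLetters f)) = (out O ls).map f := by
  have key : ∀ (P : X → List A), (ls.map (mapLetters f)).foldl act (fun x => (P x).map f) =
      fun x => (ls.foldl act P x).map f := by
    induction ls with
    | nil => intro P; rfl
    | cons σ ls ih =>
      intro P
      have h : act (fun x => (P x).map f) (mapLetters f σ) = fun x => (act P σ x).map f :=
        funext fun x => ev_map f P (σ x)
      rw [List.map_cons, List.foldl_cons, h, ih, List.foldl_cons]
  rw [out_eq_foldl, out_eq_foldl]
  exact congrFun (key fun _ => []) O

theorem mapLetters_mapLetters {C : Type*} (g : B → C) (f : A → B) (σ : Subst X A) :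
    mapLetters g (mapLetters f σ) = mapLetters (g ∘ f) σ := by
  funext x
  simp [mapLetters]

theorem ext_map (f : A → B) (σ : Subst X A) (w : List (X ⊕ A)) :
    ext (mapLetters f σ) (w.map (Sum.map id f)) = (ext σ w).map (Sum.map id f) := by
  induction w with
  | nil => rfl
  | cons a w ih => cases a <;> simp_all [ext, mapLetters]

theorem compList_map (f : A → B) (ls : List (Subst X A)) :
    compList (ls.map (mapLetters f)) = mapLetters f (compList ls) := by
  induction ls with
  | nil => funext x; simp [compList, idSubst, mapLetters]
  | cons σ ls ih =>
    funext x
    have : compList (List.map (mapLetters f) (σ :: ls)) x =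
        ext (mapLetters f σ) (compList (ls.map (mapLetters f)) x) := rfl
    rw [this, ih]
    exact ext_map f σ (compList ls x)

theorem Subst.Copyless.mapLetters {σ : Subst X A} (h : σ.Copyless) (f : A → B) :
    (mapLetters f σ).Copyless :=
  ⟨fun x => by simpa [SSTDelay.mapLetters, varsOf_map] using h.nodup x,
    fun x y hxy => by simpa [SSTDelay.mapLetters, varsOf_map] using h.disjoint x y hxy⟩

theorem varsOf_ext (σ : Subst X A) (w : List (X ⊕ A)) :
    varsOf (ext σ w) = (varsOf w).flatMap fun y => varsOf (σ y) := by
  induction w with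
  | nil => rfl
  | cons a w ih => cases a <;> simp_all [ext]

theorem mem_lettersOf_ext {σ : Subst X A} {w : List (X ⊕ A)} {a : A}
    (h : a ∈ lettersOf (ext σ w)) : (∃ y, a ∈ lettersOf (σ y)) ∨ a ∈ lettersOf w := by
  induction w with
  | nil => simp [ext] at h
  | cons b w ih => cases b <;> simp_all [ext] <;> grind

theorem Subst.Copyless.comp {σ τ : Subst X A} (hσ : σ.Copyless) (hτ : τ.Copyless) :
    (comp σ τ).Copyless where
  nodup x := by
    rw [Subst.comp, varsOf_ext, List.nodup_flatMap]
    exact ⟨fun y _ => hσ.nodup y, (hτ.nodup x).imp fun h => hσ.disjoint _ _ h⟩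
  disjoint x y hxy := by
    rw [Subst.comp, Subst.comp, varsOf_ext, varsOf_ext]
    intro z hz hz'
    rw [List.mem_flatMap] at hz hz'
    obtain ⟨u, hu, hzu⟩ := hz
    obtain ⟨v, hv, hzv⟩ := hz'
    have huv : u = v := by
      by_contra h
      exact hσ.disjoint u v h hzu hzv
    exact hτ.disjoint x y hxy hu (huv ▸ hv)

theorem copyless_compList {ls : List (Subst X A)} (h : ∀ σ ∈ ls, σ.Copyless) :
    (compList ls).Copyless := by
  induction ls with
  | nil => exact ⟨fun x => by simp [compList, idSubst], fun x y hxy => by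
      simpa [compList, idSubst] using hxy.symm⟩
  | cons σ ls ih =>
    exact Subst.Copyless.comp (h σ (by simp)) (ih fun τ hτ => h τ (by simp [hτ]))

theorem ext_comp (σ τ : Subst X A) (w : List (X ⊕ A)) : ext (comp σ τ) w = ext σ (ext τ w) := by
  induction w with
  | nil => rfl
  | cons a w ih => cases a <;> simp_all [ext, comp]

theorem compList_append (ls ms : List (Subst X A)) (x : X) :
    compList (ls ++ ms) x = ext (compList ls) (compList ms x) := by
  induction ls with
  | nil =>
    have : ∀ w : List (X ⊕ A), ext (idSubst X A) w = w := by
      intro w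
      induction w with
      | nil => rfl
      | cons a w ih => cases a <;> simp_all [ext, idSubst]
    exact (this _).symm
  | cons σ ls ih =>
    have h : compList (σ :: ls ++ ms) x = ext σ (compList (ls ++ ms) x) := rfl
    rw [h, ih, ← ext_comp]
    rfl

theorem mem_lettersOf_compList {ls : List (Subst X A)} {x : X} {a : A}
    (h : a ∈ lettersOf (compList ls x)) : ∃ σ ∈ ls, ∃ y, a ∈ lettersOf (σ y) := by
  induction ls generalizing x with
  | nil => simp [compList, idSubst] at h
  | cons σ ls ih =>
    rcases mem_lettersOf_ext (σ := σ) (w := compList ls x) h with ⟨y, hy⟩ | h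
    · exact ⟨σ, by simp, y, hy⟩
    · obtain ⟨τ, hτ, y, hy⟩ := ih h
      exact ⟨τ, by simp [hτ], y, hy⟩

end Eval

/-! ### Counting the letters of the output -/

section Count

open Subst

variable {X A B : Type*} [Fintype X]

/-- The number of occurrences of letters with property `p` in the images of all variables. -/
def letterCount (p : A → Bool) (σ : Subst X A) : ℕ := ∑ x, (lettersOf (σ x)).countP p

/-- A copyless substitution uses the content of every variable at most once. -/
theorem Subst.Copyless.sum_le {σ : Subst X A} (h : σ.Copyless) (g : X → ℕ) :
    ∑ x, ((varsOf (σ x)).map g).sum ≤ ∑ y, g y := by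
  classical
  calc ∑ x, ((varsOf (σ x)).map g).sum = ∑ x, ∑ y ∈ (varsOf (σ x)).toFinset, g y :=
        Finset.sum_congr rfl fun x _ => (List.sum_toFinset g (h.nodup x)).symm
    _ = ∑ y ∈ Finset.univ.biUnion fun x => (varsOf (σ x)).toFinset, g y := by
        rw [Finset.sum_biUnion]
        intro x _ y _ hxy
        exact List.disjoint_toFinset_iff_disjoint.2 (h.disjoint x y hxy)
    _ ≤ ∑ y, g y := Finset.sum_le_sum_of_subset (Finset.subset_univ _)

theorem sum_countP_foldl_le (p : A → Bool) {ls : List (Subst X A)} (h : ∀ σ ∈ ls, σ.Copyless)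
    (P : X → List A) :
    ∑ x, (ls.foldl act P x).countP p ≤ ∑ x, (P x).countP p + (ls.map (letterCount p)).sum := by
  induction ls generalizing P with
  | nil => simp
  | cons σ ls ih =>
    have h₁ := ih (fun τ hτ => h τ (by simp [hτ])) (act P σ)
    have h₂ : ∑ x, (act P σ x).countP p ≤ letterCount p σ + ∑ x, (P x).countP p := by
      simp only [act, countP_ev, Finset.sum_add_distrib, letterCount]
      exact Nat.add_le_add_left ((h σ (by simp)).sum_le fun y => (P y).countP p) _
    simp only [List.foldl_cons, List.map_cons, List.sum_cons]
    omega

theorem countP_out_le (p : A → Bool) (O : X) {ls : List (Subst X A)} (h : ∀ σ ∈ ls, σ.Copyless) :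
    (out O ls).countP p ≤ (ls.map (letterCount p)).sum := by
  rw [out_eq_foldl]
  calc _ ≤ ∑ x, (ls.foldl act (fun _ => []) x).countP p :=
        Finset.single_le_sum (f := fun x => (ls.foldl act (fun _ => []) x).countP p)
          (fun _ _ => Nat.zero_le _) (Finset.mem_univ O)
    _ ≤ _ := by simpa using sum_countP_foldl_le p h fun _ => []

/-- The number of letters in the images of all variables. -/
def size (σ : Subst X A) : ℕ := letterCount (fun _ => true) σ

theorem letterCount_mapLetters (p : B → Bool) (f : A → B) (σ : Subst X A) :
    letterCount p (mapLetters f σ) = letterCount (p ∘ f) σ := by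
  simp [letterCount, mapLetters, lettersOf_map, List.countP_map]

theorem size_mapLetters (f : A → B) (σ : Subst X A) : size (mapLetters f σ) = size σ :=
  letterCount_mapLetters _ f σ

end Count

/-! ### Families of words with pumped blocks -/

section Fam

variable {A : Type*}

theorem wordPow_zero (v : List A) : wordPow v 0 = [] := rfl

theorem wordPow_succ (v : List A) (n : ℕ) : wordPow v (n + 1) = v ++ wordPow v n := rfl

theorem wordPow_succ' (v : List A) (n : ℕ) : wordPow v (n + 1) = wordPow v n ++ v := by
  simp [wordPow, List.replicate_succ']

theorem length_wordPow (v : List A) (n : ℕ) : (wordPow v n).length = n * v.length := by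
  simp [wordPow]

/-- The words `p vⁿ⁻¹ q` for `n ≥ 1`, and `r` for `n = 0`. -/
def blockWord (p v q r : List A) : ℕ → List A
  | 0 => r
  | n + 1 => p ++ wordPow v n ++ q

/-- Families of words that are concatenations of fixed letters outside `loop` and of blocks
`p vⁿ⁻¹ q` (which become `r` for `n = 0`) of letters in `loop` with `|v| ≤ l`.  The condition on the
lengths makes the length of a block an affine function of `n`, the value at `n = 0` included. -/
inductive Fam (loop : A → Prop) (l : ℕ) : (ℕ → List A) → Prop
  | nil : Fam loop l fun _ => []
  | letter {c : A} {f : ℕ → List A} (hc : ¬ loop c) (hf : Fam loop l f) :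
      Fam loop l fun n => c :: f n
  | block {p v q r : List A} {f : ℕ → List A} (hp : ∀ a ∈ p, loop a) (hv : ∀ a ∈ v, loop a)
      (hq : ∀ a ∈ q, loop a) (hr : ∀ a ∈ r, loop a)
      (hlen : p.length + q.length = r.length + v.length) (hl : v.length ≤ l) (hf : Fam loop l f) :
      Fam loop l fun n => blockWord p v q r n ++ f n

namespace Fam

variable {loop : A → Prop} {l : ℕ} {f g : ℕ → List A}

theorem append (hf : Fam loop l f) (hg : Fam loop l g) : Fam loop l fun n => f n ++ g n := by
  induction hf with
  | nil => exact hg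
  | letter hc _ ih => exact ih.letter hc
  | block hp hv hq hr hlen hl _ ih =>
    simpa only [List.append_assoc] using ih.block hp hv hq hr hlen hl

theorem const (w : List A) : Fam loop l fun _ => w := by
  classical
  induction w with
  | nil => exact .nil
  | cons c w ih =>
    by_cases hc : loop c
    · have := ih.block (p := [c]) (v := []) (q := []) (r := [c]) (by simpa) (by simp) (by simp)
        (by simpa) (by simp) (by simp)
      convert this using 2 with n
      cases n <;> simp [blockWord, wordPow]
    · exact ih.letter hc

theorem exists_length (hf : Fam loop l f) : ∃ d, ∀ n, (f n).length = (f 0).length + n * d := by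
  induction hf with
  | nil => exact ⟨0, by simp⟩
  | letter _ _ ih =>
    obtain ⟨d, hd⟩ := ih
    exact ⟨d, fun n => by have := hd n; simp only [List.length_cons]; omega⟩
  | @block p v q r f _ _ _ _ hlen _ _ ih =>
    obtain ⟨d, hd⟩ := ih
    refine ⟨v.length + d, fun n => ?_⟩
    cases n with
    | zero => simp
    | succ n =>
      have := hd (n + 1)
      simp only [blockWord, List.length_append, length_wordPow]
      rw [this]
      linear_combination hlen

theorem countP_eq (hf : Fam loop l f) {p : A → Bool} (hp : ∀ a, loop a → p a = false) (n : ℕ) :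
    (f n).countP p = (f 1).countP p := by
  have key : ∀ w : List A, (∀ a ∈ w, loop a) → w.countP p = 0 := fun w hw => by
    simpa [List.countP_eq_zero] using fun a ha => hp a (hw a ha)
  induction hf with
  | nil => rfl
  | letter _ _ ih => simp [List.countP_cons, ih]
  | @block b v q r f hb hv hq hr _ _ _ ih =>
    have hpow : ∀ n, (wordPow v n).countP p = 0 := fun n =>
      key _ fun a ha => hv a (by
        simp only [wordPow, List.mem_flatten, List.mem_replicate] at ha
        grind)
    cases n with
    | zero => simp [blockWord, key _ hb, key _ hr, key _ hq, hpow, ih]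
    | succ n => simp [blockWord, key _ hb, key _ hq, hpow, ih]

theorem eq_nil (hf : Fam loop l f) (h : f 1 = []) (n : ℕ) : f n = [] := by
  obtain ⟨d, hd⟩ := hf.exists_length
  have h₁ := hd 1
  rw [h] at h₁
  simp only [List.length_nil, one_mul] at h₁
  have hd0 : d = 0 := by omega
  have h₂ := hd n
  rw [hd0] at h₂
  exact List.length_eq_zero_iff.1 (by omega)

theorem split_letter (hf : Fam loop l f) {u₁ u₂ : List A} {c : A} (hc : ¬ loop c)
    (h : f 1 = u₁ ++ c :: u₂) :
    ∃ f₁ f₂, Fam loop l f₁ ∧ Fam loop l f₂ ∧ f₁ 1 = u₁ ∧ f₂ 1 = u₂ ∧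
      ∀ n, f n = f₁ n ++ c :: f₂ n := by
  induction hf generalizing u₁ with
  | nil => simp at h
  | @letter b f hb hf ih =>
    cases u₁ with
    | nil =>
      simp only [List.nil_append, List.cons.injEq] at h
      exact ⟨_, f, .nil, hf, rfl, h.2, fun n => by simp [h.1]⟩
    | cons b' u₁ =>
      simp only [List.cons_append, List.cons.injEq] at h
      obtain ⟨f₁, f₂, h₁, h₂, h₃, h₄, h₅⟩ := ih h.2
      exact ⟨_, f₂, h₁.letter hb, h₂, by simp [h₃, h.1], h₄, fun n => by simp [h₅]⟩
  | @block p v q r f hp hv hq hr hlen hl hf ih =>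
    have hpq : ∀ a ∈ p ++ q, loop a := fun a ha => (List.mem_append.1 ha).elim (hp a) (hq a)
    have h' : (p ++ q) ++ f 1 = u₁ ++ c :: u₂ := by simpa [blockWord, wordPow_zero] using h
    obtain ⟨u, hu, hfu⟩ : ∃ u, u₁ = (p ++ q) ++ u ∧ f 1 = u ++ c :: u₂ := by
      rcases List.append_eq_append_iff.1 h' with ⟨u, hu, hfu⟩ | ⟨s, hs, hfs⟩
      · exact ⟨u, hu, hfu⟩
      · cases s with
        | nil => exact ⟨[], by simpa using hs.symm, by simpa using hfs.symm⟩
        | cons b s =>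
          simp only [List.cons_append, List.cons.injEq] at hfs
          exact absurd (hpq c (by simp [hs, hfs.1])) hc
    obtain ⟨f₁, f₂, h₁, h₂, h₃, h₄, h₅⟩ := ih hfu
    refine ⟨_, f₂, h₁.block hp hv hq hr hlen hl, h₂, ?_, h₄, fun n => by simp [h₅]⟩
    simp [blockWord, wordPow_zero, hu, h₃]

theorem split_prefix (hf : Fam loop l f) {w u : List A} (hw : ∀ a ∈ w, ¬ loop a)
    (h : f 1 = w ++ u) : ∃ g, Fam loop l g ∧ g 1 = u ∧ ∀ n, f n = w ++ g n := by
  induction w generalizing f with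
  | nil => exact ⟨f, hf, h, fun _ => rfl⟩
  | cons c w ih =>
    obtain ⟨f₁, f₂, h₁, h₂, h₃, h₄, h₅⟩ := hf.split_letter (u₁ := []) (hw c (by simp)) h
    obtain ⟨g, hg, hgu, hfg⟩ := ih h₂ (fun a ha => hw a (by simp [ha])) h₄
    exact ⟨g, hg, hgu, fun n => by simp [h₅, h₁.eq_nil h₃, hfg]⟩

/-- A nonempty factor without loop letters stays in place in all members of the family. -/
theorem split (hf : Fam loop l f) {u₁ w u₂ : List A} (hw : ∀ a ∈ w, ¬ loop a) (hne : w ≠ [])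
    (h : f 1 = u₁ ++ w ++ u₂) :
    ∃ f₁ f₂, Fam loop l f₁ ∧ Fam loop l f₂ ∧ f₁ 1 = u₁ ∧ f₂ 1 = u₂ ∧
      ∀ n, f n = f₁ n ++ w ++ f₂ n := by
  cases w with
  | nil => exact absurd rfl hne
  | cons c w =>
    obtain ⟨f₁, f₂, h₁, h₂, h₃, h₄, h₅⟩ := hf.split_letter (u₁ := u₁) (u₂ := w ++ u₂)
      (hw c (by simp)) (by simpa using h)
    obtain ⟨g, hg, hgu, hfg⟩ := h₂.split_prefix (fun a ha => hw a (by simp [ha])) h₄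
    exact ⟨f₁, g, h₁, hg, h₃, hgu, fun n => by simp [h₅, hfg]⟩

/-- A position that is right of `f 1`, and moves to the right more slowly than the end of `f n`
does, is far inside of a power `vⁿ` when `n` is large. -/
theorem infix_wordPow (hf : Fam loop l f) {d P C N : ℕ} (hd : (f 0).length + d < (f 1).length)
    (hP : (f 1).length ≤ P) (hN : P + C ≤ N) (u : List A) :
    ∃ v m, v ≠ [] ∧ v.length ≤ l ∧
      ((f (N + 1) ++ u).drop (P + N * d)).take C <:+: wordPow v m := by
  induction hf generalizing d P with
  | nil => simp at hd
  | @letter c f _ _ ih =>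
    simp only [List.length_cons] at hd hP
    obtain ⟨P, rfl⟩ : ∃ P', P = P' + 1 := ⟨P - 1, by omega⟩
    obtain ⟨v, m, h₁, h₂, h₃⟩ := ih (d := d) (P := P) (by omega) (by omega) (by omega)
    exact ⟨v, m, h₁, h₂, by simpa [Nat.add_right_comm P 1] using h₃⟩
  | @block p v q r f _ _ _ _ hlen hl _ ih =>
    simp only [blockWord, List.length_append, wordPow_zero, List.length_nil] at hd hP
    by_cases hdv : d < v.length
    · refine ⟨v, N, List.ne_nil_of_length_pos (by omega), hl, ?_⟩
      have hNv : N * d + N ≤ N * v.length := by nlinarith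
      have h₁ : (blockWord p v q r (N + 1) ++ f (N + 1) ++ u).drop (P + N * d) =
          (wordPow v N).drop (P + N * d - p.length) ++ (q ++ (f (N + 1) ++ u)) := by
        simp only [blockWord, List.append_assoc]
        rw [List.drop_append, List.drop_eq_nil_of_le (by omega), List.nil_append,
          List.drop_append_of_le_length (by rw [length_wordPow]; omega)]
      rw [h₁, List.take_append_of_le_length (by rw [List.length_drop, length_wordPow]; omega)]
      exact (List.take_prefix _ _).isInfix.trans (List.drop_suffix _ _).isInfix
    · obtain ⟨e, rfl⟩ : ∃ e, d = v.length + e := ⟨d - v.length, by omega⟩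
      obtain ⟨P, rfl⟩ : ∃ P', P = p.length + q.length + P' :=
        ⟨P - (p.length + q.length), by omega⟩
      obtain ⟨v', m, h₁, h₂, h₃⟩ := ih (d := e) (P := P) (by omega) (by omega) (by omega)
      refine ⟨v', m, h₁, h₂, ?_⟩
      have h₄ : p.length + q.length + P + N * (v.length + e) =
          (blockWord p v q r (N + 1)).length + (P + N * e) := by
        simp only [blockWord, List.length_append, length_wordPow]
        ring
      rw [h₄, List.append_assoc, List.drop_length_add_append]
      exact h₃

end Fam

/-- A factor of a power of a nonempty word of length at most `l`. -/
def Repetitive (l : ℕ) (w : List A) : Prop := ∃ v m, v ≠ [] ∧ v.length ≤ l ∧ w <:+: wordPow v m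

/-- If the parts of two equal families that are left of a common factor grow at different speeds,
then the factor is repetitive: as seen from the slower family, it ends up far inside of a pumped
block of the faster one. -/
theorem Fam.repetitive_of_slope_lt {B : Type*} {loop : A → Prop} {l d d' : ℕ}
    {f₁ f₂ g₁ g₂ : ℕ → List A} {w w' : List A} {π : A → B} (hf : Fam loop l f₁)
    (heq : ∀ n, (f₁ n ++ w ++ f₂ n).map π = (g₁ n ++ w' ++ g₂ n).map π)
    (hd : ∀ n, (f₁ n).length = (f₁ 0).length + n * d)
    (hd' : ∀ n, (g₁ n).length = (g₁ 0).length + n * d')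
    (hlen : (f₁ 1).length = (g₁ 1).length) (hlt : d' < d) : Repetitive l (w'.map π) := by
  set P := (f₁ 1).length
  obtain ⟨v, m, hv, hvl, h⟩ := hf.infix_wordPow (d := d') (P := P) (C := w'.length)
    (N := P + w'.length) (by have := hd 1; omega) le_rfl le_rfl
    (w ++ f₂ (P + w'.length + 1))
  refine ⟨v.map π, m, by simpa using hv, by simpa using hvl, ?_⟩
  set N := P + w'.length
  have h' := h.map π
  have hpos : P + N * d' = (g₁ (N + 1)).length := by
    have h1 := hd' 1
    rw [hd' (N + 1), Nat.succ_mul]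
    clear_value N
    omega
  rw [List.map_take, List.map_drop, ← List.append_assoc, heq] at h'
  have hw : (((g₁ (N + 1) ++ w' ++ g₂ (N + 1)).map π).drop (P + N * d')).take w'.length =
      w'.map π := by
    rw [hpos]
    simp only [List.map_append, List.append_assoc]
    rw [List.drop_left' (by simp), List.take_left' (by simp)]
  rw [hw] at h'
  simpa [wordPow] using h'

/-- If two families are equal up to `π`, and have a common factor that is not repetitive or lies
at an end of the words, then the factor is at the same position in both words for `n = 0` if
it is so for `n = 1`. -/
theorem Fam.position_eq {B : Type*} {loop : A → Prop} {l : ℕ} {f₁ f₂ g₁ g₂ : ℕ → List A}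
    {w w' : List A} {π : A → B} (hf₁ : Fam loop l f₁) (hf₂ : Fam loop l f₂)
    (hg₁ : Fam loop l g₁) (hg₂ : Fam loop l g₂)
    (heq : ∀ n, (f₁ n ++ w ++ f₂ n).map π = (g₁ n ++ w' ++ g₂ n).map π)
    (hlen : (f₁ 1).length = (g₁ 1).length) (hw : w.length = w'.length)
    (hbreak : ¬ Repetitive l (w.map π) ∨ f₁ 1 = [] ∨ f₂ 1 = []) :
    (f₁ 0).length = (g₁ 0).length := by
  rcases hbreak with h | h | h
  · obtain ⟨d, hd⟩ := hf₁.exists_length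
    obtain ⟨d', hd'⟩ := hg₁.exists_length
    have hww : w.map π = w'.map π := by
      have h1 := heq 1
      simp only [List.map_append, List.append_assoc] at h1
      exact (List.append_inj (List.append_inj h1 (by simpa using hlen)).2 (by simpa using hw)).1
    rcases lt_trichotomy d d' with hlt | rfl | hlt
    · exact absurd (hg₁.repetitive_of_slope_lt (fun n => (heq n).symm) hd' hd hlen.symm hlt) h
    · have h1 := hd 1
      have h2 := hd' 1
      omega
    · exact absurd (hf₁.repetitive_of_slope_lt heq hd hd' hlen hlt) (hww ▸ h)
  · have hg : g₁ 1 = [] := List.length_eq_zero_iff.1 (by rw [← hlen, h]; rfl)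
    rw [hf₁.eq_nil h, hg₁.eq_nil hg]
  · have h1 := congrArg List.length (heq 1)
    have h0 := congrArg List.length (heq 0)
    have hg : g₂ 1 = [] := by
      simp only [List.map_append, List.length_append, List.length_map, h, List.length_nil] at h1
      exact List.length_eq_zero_iff.1 (by omega)
    rw [hf₂.eq_nil h, hg₂.eq_nil hg] at h0
    simp only [List.map_append, List.length_append, List.length_map, List.length_nil] at h0
    omega

end Fam

/-! ### Pumping a loop with idempotent flow of variables -/

section Pump

open Subst

variable {X A : Type*}

/-- For an idempotent copyless flow `e`, a variable is either erased or flows into itself,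
and everything that flows into it beside itself is erased. -/
theorem idempotent_flow {e : X → List X} (hdisj : ∀ x y, x ≠ y → (e x).Disjoint (e y))
    (he : ∀ x, (e x).flatMap e = e x) (x : X) :
    e x = [] ∨ ∃ α β, e x = α ++ x :: β ∧ (∀ y ∈ α, e y = []) ∧ ∀ y ∈ β, e y = [] := by
  rcases List.eq_nil_or_concat (e x) with h | ⟨_, y, hy⟩
  · exact Or.inl h
  right
  have hyx : y ∈ e x := by simp [hy]
  have hxx : x ∈ e x := by
    have h := hyx
    rw [← he x, List.mem_flatMap] at h
    obtain ⟨z, hz, hyz⟩ := h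
    have : z = x := by
      by_contra hne
      exact hdisj z x hne hyz hyx
    exact this ▸ hz
  obtain ⟨α, β, hαβ⟩ := List.append_of_mem hxx
  have h := congrArg List.length (he x)
  rw [hαβ, List.flatMap_append, List.flatMap_cons, hαβ] at h
  simp only [List.length_append] at h
  have h₁ : α.flatMap e = [] := List.length_eq_zero_iff.1 (by omega)
  have h₂ : β.flatMap e = [] := List.length_eq_zero_iff.1 (by omega)
  exact ⟨α, β, hαβ, List.flatMap_eq_nil_iff.1 h₁, List.flatMap_eq_nil_iff.1 h₂⟩

theorem exists_of_varsOf_eq {w : List (X ⊕ A)} {α β : List X} {x : X}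
    (h : varsOf w = α ++ x :: β) :
    ∃ u v, w = u ++ Sum.inl x :: v ∧ varsOf u = α ∧ varsOf v = β := by
  induction w generalizing α with
  | nil => simp at h
  | cons b w ih =>
    cases b with
    | inr a =>
      obtain ⟨u, v, rfl, hu, hv⟩ := ih (α := α) (by simpa using h)
      exact ⟨Sum.inr a :: u, v, rfl, by simpa using hu, hv⟩
    | inl y =>
      cases α with
      | nil =>
        simp only [varsOf_cons_inl, List.nil_append, List.cons.injEq] at h
        exact ⟨[], w, by simp [h.1], rfl, h.2⟩
      | cons z α =>
        simp only [varsOf_cons_inl, List.cons_append, List.cons.injEq] at h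
        obtain ⟨u, v, rfl, hu, hv⟩ := ih h.2
        exact ⟨Sum.inl y :: u, v, rfl, by simp [hu, h.1], hv⟩

/-- The contents of the variables after the update `s₁` and `n` updates `s₂`. -/
def pumpContent (P : X → List A) (s₁ s₂ : Subst X A) : ℕ → X → List A
  | 0 => act P s₁
  | n + 1 => act (pumpContent P s₁ s₂ n) s₂

theorem length_ev (P : X → List A) (w : List (X ⊕ A)) :
    (ev P w).length = (lettersOf w).length + ((varsOf w).map fun y => (P y).length).sum := by
  simpa only [List.countP_true] using countP_ev (fun _ => true) P w

variable {P : X → List A} {s₁ s₂ s₃ : Subst X A} {e : X → List X}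

/-- A variable that is erased by the flow holds only the letters of the last update. -/
theorem pumpContent_of_erased (h₁ : ∀ x, varsOf (s₁ x) = e x) {y : X} (hy : e y = []) :
    pumpContent P s₁ s₂ 0 y = lettersOf (s₁ y) :=
  ev_eq_lettersOf _ (by rw [h₁, hy])

theorem pumpContent_succ_of_erased (h₂ : ∀ x, varsOf (s₂ x) = e x) {y : X} (hy : e y = [])
    (n : ℕ) : pumpContent P s₁ s₂ (n + 1) y = lettersOf (s₂ y) :=
  ev_eq_lettersOf _ (by rw [h₂, hy])

theorem ev_pumpContent (h₁ : ∀ x, varsOf (s₁ x) = e x) {w : List (X ⊕ A)}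
    (hw : ∀ y ∈ varsOf w, e y = []) :
    ev (pumpContent P s₁ s₂ 0) w = ev (fun y => lettersOf (s₁ y)) w :=
  ev_congr fun y hy => pumpContent_of_erased h₁ (hw y hy)

theorem ev_pumpContent_succ (h₂ : ∀ x, varsOf (s₂ x) = e x) {w : List (X ⊕ A)}
    (hw : ∀ y ∈ varsOf w, e y = []) (n : ℕ) :
    ev (pumpContent P s₁ s₂ (n + 1)) w = ev (fun y => lettersOf (s₂ y)) w :=
  ev_congr fun y hy => pumpContent_succ_of_erased h₂ (hw y hy) n

/-- A variable that flows into itself gains one more copy of a fixed word on either side in every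
round after the first; the first round flushes the erased variables as filled by `s₁`. -/
theorem pumpContent_succ_eq (h₂ : ∀ x, varsOf (s₂ x) = e x) {x : X} {u v : List (X ⊕ A)}
    (hx : s₂ x = u ++ Sum.inl x :: v) (hu : ∀ y ∈ varsOf u, e y = [])
    (hv : ∀ y ∈ varsOf v, e y = []) (n : ℕ) :
    pumpContent P s₁ s₂ (n + 1) x =
      wordPow (ev (fun y => lettersOf (s₂ y)) u) n ++ ev (pumpContent P s₁ s₂ 0) u ++
        pumpContent P s₁ s₂ 0 x ++
        (ev (pumpContent P s₁ s₂ 0) v ++ wordPow (ev (fun y => lettersOf (s₂ y)) v) n) := by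
  have hstep : ∀ n, pumpContent P s₁ s₂ (n + 1) x = ev (pumpContent P s₁ s₂ n) u ++
      pumpContent P s₁ s₂ n x ++ ev (pumpContent P s₁ s₂ n) v := fun n => by
    simp [pumpContent, act, hx]
  induction n with
  | zero => simp [hstep, wordPow_zero]
  | succ n ih =>
    rw [hstep, ih, ev_pumpContent_succ h₂ hu, ev_pumpContent_succ h₂ hv, wordPow_succ,
      wordPow_succ']
    simp only [List.append_assoc]

variable {loop : A → Prop} {l : ℕ}

/-- The content of a variable after `s₁`, `n` times `s₂`, and `s₃`. -/
theorem fam_content (h₁ : ∀ x, varsOf (s₁ x) = e x) (h₂ : ∀ x, varsOf (s₂ x) = e x)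
    (h₃ : ∀ x, varsOf (s₃ x) = e x) (hdisj : ∀ x y, x ≠ y → (e x).Disjoint (e y))
    (he : ∀ x, (e x).flatMap e = e x)
    (hl₁ : ∀ x, ∀ a ∈ lettersOf (s₁ x), loop a) (hl₂ : ∀ x, ∀ a ∈ lettersOf (s₂ x), loop a)
    (hl₃ : ∀ x, ∀ a ∈ lettersOf (s₃ x), loop a)
    (hsize : ∀ x, (act (act (fun _ => []) s₂) s₂ x).length ≤ l) (x : X) :
    Fam loop l fun n => act (pumpContent P s₁ s₂ n) s₃ x := by
  rcases idempotent_flow hdisj he x with hx | ⟨α, β, hx, hα, hβ⟩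
  · have : (fun n => act (pumpContent P s₁ s₂ n) s₃ x) = fun _ => lettersOf (s₃ x) :=
      funext fun n => ev_eq_lettersOf _ (by rw [h₃, hx])
    rw [this]
    exact Fam.const _
  obtain ⟨u₂, v₂, hs₂, hu₂, hv₂⟩ := exists_of_varsOf_eq ((h₂ x).trans hx)
  obtain ⟨u₃, v₃, hs₃, hu₃, hv₃⟩ := exists_of_varsOf_eq ((h₃ x).trans hx)
  rw [← hu₂] at hα
  rw [← hv₂] at hβ
  have hα₃ : ∀ y ∈ varsOf u₃, e y = [] := by rwa [hu₃, ← hu₂]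
  have hβ₃ : ∀ y ∈ varsOf v₃, e y = [] := by rwa [hv₃, ← hv₂]
  have hloop : ∀ (s : Subst X A) (w : List (X ⊕ A)), (∀ x, ∀ a ∈ lettersOf (s x), loop a) →
      (∀ a ∈ lettersOf w, loop a) → ∀ a ∈ ev (fun y => lettersOf (s y)) w, loop a := by
    intro s w hs hw a ha
    rcases mem_ev ha with ⟨y, _, hy⟩ | h
    · exact hs y a hy
    · exact hw a h
  have hlu₂ : ∀ a ∈ lettersOf u₂, loop a := fun a ha => hl₂ x a (by simp [hs₂, ha])
  have hlv₂ : ∀ a ∈ lettersOf v₂, loop a := fun a ha => hl₂ x a (by simp [hs₂, ha])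
  have hlu₃ : ∀ a ∈ lettersOf u₃, loop a := fun a ha => hl₃ x a (by simp [hs₃, ha])
  have hlv₃ : ∀ a ∈ lettersOf v₃, loop a := fun a ha => hl₃ x a (by simp [hs₃, ha])
  have herased : ∀ w : List (X ⊕ A), (∀ y ∈ varsOf w, e y = []) →
      ev (act (fun _ => []) s₂) w = ev (fun y => lettersOf (s₂ y)) w := fun w hw =>
    ev_congr fun y hy => ev_eq_lettersOf _ (by rw [h₂, hw y hy])
  have hlen := hsize x
  rw [act, hs₂, ev_append, ev_cons_inl, herased _ hα, herased _ hβ] at hlen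
  simp only [List.length_append] at hlen
  have hleft := (Fam.nil (loop := loop) (l := l)).block
    (hloop s₂ u₃ hl₂ hlu₃) (hloop s₂ u₂ hl₂ hlu₂) (hloop s₁ u₂ hl₁ hlu₂) (hloop s₁ u₃ hl₁ hlu₃)
    (by simp only [length_ev, hu₂, hu₃]; omega) (by omega)
  have hright := (Fam.nil (loop := loop) (l := l)).block
    (hloop s₁ v₂ hl₁ hlv₂) (hloop s₂ v₂ hl₂ hlv₂) (hloop s₂ v₃ hl₂ hlv₃) (hloop s₁ v₃ hl₁ hlv₃)
    (by simp only [length_ev, hv₂, hv₃]; omega) (by omega)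
  have h := (hleft.append (Fam.const (pumpContent P s₁ s₂ 0 x))).append hright
  convert h using 2 with n
  have hn : act (pumpContent P s₁ s₂ n) s₃ x = ev (pumpContent P s₁ s₂ n) u₃ ++
      (pumpContent P s₁ s₂ n x ++ ev (pumpContent P s₁ s₂ n) v₃) := by simp [act, hs₃]
  rw [hn]
  cases n with
  | zero => simp [blockWord, ev_pumpContent h₁ hα₃, ev_pumpContent h₁ hβ₃]
  | succ n =>
    rw [ev_pumpContent_succ h₂ hα₃, ev_pumpContent_succ h₂ hβ₃, pumpContent_succ_eq h₂ hs₂ hα hβ,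
      ev_pumpContent h₁ hα, ev_pumpContent h₁ hβ]
    simp [blockWord]

theorem fam_ev {F : ℕ → X → List A} (h : ∀ x, Fam loop l fun n => F n x) (w : List (X ⊕ A)) :
    Fam loop l fun n => ev (F n) w := by
  induction w with
  | nil => exact .nil
  | cons b w ih =>
    cases b with
    | inl x => simpa only [ev_cons_inl] using (h x).append ih
    | inr a =>
      simp only [ev_cons_inr]
      exact (Fam.const [a]).append ih

/-- Three consecutive factors `L₁`, `L₂`, `L₃` with the same idempotent flow of variables: if `L₂`
is repeated, the outputs form a family whose blocks consist of letters from the three factors.  The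
factor `2` is due to the pumped words, which mix the letters of two consecutive copies of `L₂`. -/
theorem fam_out [Fintype X] (O : X) (pre L₁ L₂ L₃ post : List (Subst X A))
    (hc₁ : ∀ σ ∈ L₁, σ.Copyless) (hc₂ : ∀ σ ∈ L₂, σ.Copyless)
    (h₁ : ∀ x, varsOf (compList L₁ x) = e x) (h₂ : ∀ x, varsOf (compList L₂ x) = e x)
    (h₃ : ∀ x, varsOf (compList L₃ x) = e x) (he : ∀ x, (e x).flatMap e = e x)
    (hloop : ∀ σ ∈ L₁ ++ L₂ ++ L₃, ∀ x, ∀ a ∈ lettersOf (σ x), loop a)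
    (hl : 2 * (L₂.map size).sum ≤ l) :
    Fam loop l fun n =>
      out O (pre ++ L₁ ++ (List.replicate n L₂).flatten ++ L₃ ++ post) := by
  have hfold : ∀ (Q : X → List A) (L : List (Subst X A)), L.foldl act Q = act Q (compList L) :=
    fun Q L => funext fun x => foldl_act Q L x
  have hpump : ∀ (Q : X → List A) (n : ℕ), (List.replicate n L₂).flatten.foldl act
      (act Q (compList L₁)) = pumpContent Q (compList L₁) (compList L₂) n := by
    intro Q n
    induction n with
    | zero => rfl
    | succ n ih =>
      rw [List.replicate_succ', List.flatten_append, List.foldl_append, ih]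
      simp [hfold, pumpContent]
  have hletters : ∀ L : List (Subst X A), (∀ σ ∈ L, σ ∈ L₁ ++ L₂ ++ L₃) →
      ∀ x, ∀ a ∈ lettersOf (compList L x), loop a := by
    intro L hL x a ha
    obtain ⟨σ, hσ, y, hy⟩ := mem_lettersOf_compList ha
    exact hloop σ (hL σ hσ) y a hy
  have hdisj : ∀ x y, x ≠ y → (e x).Disjoint (e y) := fun x y hxy => by
    rw [← h₁, ← h₁]
    exact (copyless_compList hc₁).disjoint x y hxy
  have hsize : ∀ x, (act (act (fun _ => []) (compList L₂)) (compList L₂) x).length ≤ l := by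
    intro x
    have hc : ∀ σ ∈ L₂ ++ L₂, σ.Copyless := fun σ hσ => hc₂ σ (by simpa using hσ)
    have h := countP_out_le (fun _ => true) x hc
    rw [out_eq_foldl, List.foldl_append, hfold, hfold, List.countP_true, List.map_append,
      List.sum_append] at h
    have : (L₂.map (letterCount fun _ => true)).sum = (L₂.map size).sum := rfl
    omega
  have h := fam_ev (fam_content (P := pre.foldl act fun _ => []) h₁ h₂ h₃ hdisj he
    (hletters L₁ fun σ hσ => by simp [hσ]) (hletters L₂ fun σ hσ => by simp [hσ])
    (hletters L₃ fun σ hσ => by simp [hσ]) hsize) (compList post O)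
  convert h using 2 with n
  rw [out_eq_foldl, List.foldl_append, List.foldl_append, List.foldl_append, List.foldl_append,
    hfold _ L₁, hpump, hfold _ L₃, hfold _ post]
  rfl

end Pump

/-! ### The cuts of the factorization -/

section Cuts

variable {A : Type*}

theorem rootLength_wordPow_le (w : List A) {k : ℕ} (hk : 0 < k) :
    rootLength (wordPow w k) ≤ w.length :=
  Nat.sInf_le ⟨w, k, rfl, hk, rfl⟩

theorem exists_root (u : List A) : ∃ w k, w.length = rootLength u ∧ 0 < k ∧ u = wordPow w k :=
  Nat.sInf_mem (s := {n | ∃ (w : List A) (k : ℕ), w.length = n ∧ 0 < k ∧ u = wordPow w k})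
    ⟨u.length, u, 1, rfl, one_pos, by simp [wordPow]⟩

theorem rootLength_take_firstFactorLength (l : ℕ) (u : List A) :
    rootLength (u.take (firstFactorLength l u)) ≤ l := by
  classical
  have h0 : rootLength (u.take 0) ≤ l :=
    (rootLength_wordPow_le ([] : List A) one_pos).trans (Nat.zero_le _)
  unfold firstFactorLength
  exact Nat.findGreatest_spec (P := fun n => rootLength (u.take n) ≤ l) (Nat.zero_le _) h0

theorem le_firstFactorLength {l n : ℕ} {u : List A} (hn : n ≤ u.length)
    (h : rootLength (u.take n) ≤ l) : n ≤ firstFactorLength l u := by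
  classical
  unfold firstFactorLength
  exact Nat.le_findGreatest hn h

theorem firstFactorLength_le (l : ℕ) (u : List A) : firstFactorLength l u ≤ u.length := by
  classical
  unfold firstFactorLength
  exact Nat.findGreatest_le _

/-- Every cut is the end of a first factor of a suffix of the word. -/
theorem exists_of_mem_cuts {l : ℕ} {u : List A} {j : ℕ} (hj : j ∈ cuts l u) :
    ∃ i, i + firstFactorLength l (u.drop i) = j ∧ i < j ∧ j ≤ u.length := by
  have key : ∀ (m : ℕ) (u : List A) (n : ℕ), u.length ≤ m → n < (factors l u).length →
      ∃ i, i + firstFactorLength l (u.drop i) = ((factors l u).take (n + 1)).flatten.length ∧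
        i < ((factors l u).take (n + 1)).flatten.length ∧
        ((factors l u).take (n + 1)).flatten.length ≤ u.length := by
    intro m
    induction m with
    | zero =>
      intro u n hu hn
      rw [factors, dif_pos (Or.inl (List.length_eq_zero_iff.1 (by omega)))] at hn
      simp at hn
    | succ m ih =>
      intro u n hu hn
      rw [factors] at hn ⊢
      split_ifs at hn ⊢ with h
      · simp at hn
      · push Not at h
        have hle := firstFactorLength_le l u
        rw [List.take_succ_cons, List.flatten_cons, List.length_append, List.length_take,
          min_eq_left hle]
        cases n with
        | zero => exact ⟨0, by simp, by simp; omega, by simpa using hle⟩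
        | succ n =>
          obtain ⟨i, h₁, h₂, h₃⟩ := ih (u.drop (firstFactorLength l u)) n
            (by rw [List.length_drop]; omega) (by simpa using hn)
          rw [List.length_drop] at h₃
          rw [List.drop_drop] at h₁
          exact ⟨firstFactorLength l u + i, by omega, by omega, by omega⟩
  obtain ⟨n, hn, rfl⟩ := Finset.mem_image.1 hj
  rw [Finset.mem_Icc] at hn
  have h := key _ u (n - 1) le_rfl (by omega)
  rwa [Nat.sub_add_cancel hn.1] at h

theorem getElem?_wordPow (v : List A) (hv : v ≠ []) {m x : ℕ} (hx : x < m * v.length) :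
    (wordPow v m)[x]? = v[x % v.length]? := by
  have hpos : 0 < v.length := List.length_pos_iff.2 hv
  induction m generalizing x with
  | zero => simp at hx
  | succ m ih =>
    rw [wordPow_succ, List.getElem?_append]
    split_ifs with h
    · rw [Nat.mod_eq_of_lt h]
    · rw [ih (by rw [Nat.succ_mul] at hx; omega), ← Nat.mod_eq_sub_mod (by omega)]

/-- A word whose letters repeat with period `p` is a power if its length is a multiple of `p`. -/
theorem eq_wordPow_of_period {u : List A} {p q : ℕ} (hu : u.length = q * p)
    (h : ∀ x, x + p < u.length → u[x + p]? = u[x]?) : u = wordPow (u.take p) q := by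
  induction q generalizing u with
  | zero => simpa [wordPow] using hu
  | succ q ih =>
    rw [Nat.succ_mul] at hu
    have hd : u.drop p = wordPow ((u.drop p).take p) q := ih (by rw [List.length_drop]; omega)
      fun x hx => by
        rw [List.length_drop] at hx
        rw [List.getElem?_drop, List.getElem?_drop, ← h (p + x) (by omega)]
        congr 1
        omega
    have ht : q ≠ 0 → (u.drop p).take p = u.take p := by
      intro hq
      have : p ≤ q * p := Nat.le_mul_of_pos_left p (by omega)
      apply List.ext_getElem?
      intro x
      rw [List.getElem?_take, List.getElem?_take]
      split_ifs with hx
      · rw [List.getElem?_drop, ← h x (by omega), Nat.add_comm]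
      · rfl
    rcases Nat.eq_zero_or_pos q with rfl | hq
    · rw [zero_mul] at hu
      simp [wordPow_succ, wordPow_zero, List.take_of_length_le (show u.length ≤ p by omega)]
    · rw [ht hq.ne'] at hd
      rw [wordPow_succ, ← hd, List.take_append_drop]

theorem period_of_infix_wordPow {w v : List A} {m : ℕ} (hv : v ≠ []) (h : w <:+: wordPow v m)
    {x : ℕ} (hx : x + v.length < w.length) : w[x + v.length]? = w[x]? := by
  obtain ⟨s, t, hst⟩ := h
  have hlen := congrArg List.length hst
  rw [List.length_append, List.length_append, length_wordPow] at hlen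
  have key : ∀ y < w.length, w[y]? = v[(s.length + y) % v.length]? := by
    intro y hy
    rw [← getElem?_wordPow v hv (m := m) (by omega), ← hst, List.append_assoc,
      List.getElem?_append_right (by omega), List.getElem?_append_left (by omega)]
    congr 1
    omega
  rw [key _ hx, key x (by omega), ← Nat.add_assoc, Nat.add_mod_right]

/-- A cut that is not near an end of the word is not far inside of a repetitive factor. -/
theorem not_repetitive_of_mem_cuts {l : ℕ} {u : List A} {j : ℕ} (hj : j ∈ cuts l u)
    (hj₁ : 2 * l ≤ j) (hj₂ : j + l ≤ u.length) :
    ¬ Repetitive l ((u.drop (j - 2 * l)).take (3 * l)) := by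
  rintro ⟨v, m, hv, hvl, h⟩
  obtain ⟨i, hij, hlt, hju⟩ := exists_of_mem_cuts hj
  have hvpos : 0 < v.length := List.length_pos_iff.2 hv
  -- the window `j - 2 * l ≤ x < j + l` has the period `p`
  set p := v.length
  have hper : ∀ x, j - 2 * l ≤ x → x + p < j + l → u[x + p]? = u[x]? := by
    intro x hx₁ hx₂
    have h' := period_of_infix_wordPow hv h (x := x - (j - 2 * l))
      (by rw [List.length_take, List.length_drop]; omega)
    rw [List.getElem?_take, List.getElem?_take, List.getElem?_drop, List.getElem?_drop,
      if_pos (by omega), if_pos (by omega)] at h'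
    convert h' using 2 <;> omega
  by_cases hi : j - 2 * l ≤ i
  · -- the factor can be prolonged to a power of a word of length `p` that ends behind `j`
    set q := (j + l - i) / p
    have hq₁ : q * p ≤ j + l - i := Nat.div_mul_le_self _ _
    have hq₂ : j + l - i < q * p + p := Nat.lt_div_mul_add hvpos
    have hlen : ((u.drop i).take (q * p)).length = q * p := by
      rw [List.length_take, List.length_drop]; omega
    have hpow := eq_wordPow_of_period hlen fun x hx => by
      rw [List.getElem?_take, List.getElem?_take, List.getElem?_drop, List.getElem?_drop,
        if_pos (by omega), if_pos (by omega), ← Nat.add_assoc]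
      exact hper (i + x) (by omega) (by omega)
    have hqpos : 0 < q := by
      rcases Nat.eq_zero_or_pos q with h0 | h0
      · rw [h0] at hq₂; omega
      · exact h0
    have hroot : rootLength ((u.drop i).take (q * p)) ≤ l := by
      rw [hpow]
      refine (rootLength_wordPow_le _ hqpos).trans ?_
      rw [List.length_take]
      omega
    have := le_firstFactorLength (by rw [List.length_drop]; omega) hroot
    omega
  · -- the period of the factor continues behind `j`, since the window contains both periods
    obtain ⟨r, k, hr, hk, hrk⟩ := exists_root ((u.drop i).take (firstFactorLength l (u.drop i)))
    have hrl : r.length ≤ l := hr ▸ rootLength_take_firstFactorLength l (u.drop i)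
    have hflen : ((u.drop i).take (firstFactorLength l (u.drop i))).length = j - i := by
      rw [List.length_take, List.length_drop]; omega
    have hjk : j - i = k * r.length := by rw [← hflen, hrk, length_wordPow]
    have hrne : r ≠ [] := by
      rintro rfl
      simp at hjk
      omega
    have hrpos : 0 < r.length := List.length_pos_iff.2 hrne
    have hperr : ∀ x, i ≤ x → x + r.length < j → u[x + r.length]? = u[x]? := by
      intro x hx₁ hx₂
      have h' := period_of_infix_wordPow hrne (w := wordPow r k) (m := k) (List.infix_refl _)
        (x := x - i) (by rw [length_wordPow, ← hjk]; omega)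
      rw [← hrk, List.getElem?_take, List.getElem?_take, List.getElem?_drop, List.getElem?_drop,
        if_pos (by omega), if_pos (by omega)] at h'
      convert h' using 2 <;> omega
    have hshift : ∀ c x, j - 2 * l ≤ x → x + c * p < j + l → u[x + c * p]? = u[x]? := by
      intro c
      induction c with
      | zero => simp
      | succ c ih =>
        intro x hx₁ hx₂
        rw [Nat.succ_mul] at hx₂ ⊢
        rw [← Nat.add_assoc, hper _ (by omega) (by omega), ih x hx₁ (by omega)]
    have hperr' : ∀ x, i ≤ x → x + r.length < j + r.length → u[x + r.length]? = u[x]? := by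
      intro x hx₁ hx₂
      by_cases hx : x + r.length < j
      · exact hperr x hx₁ hx
      -- move the position to the left by a multiple of `p`, to just before `j`
      obtain ⟨c, y, hy, hyj, hyp⟩ : ∃ c y, x + r.length = y + c * p ∧ y < j ∧ j ≤ y + p := by
        refine ⟨(x + r.length - j) / p + 1,
          x + r.length - ((x + r.length - j) / p + 1) * p, ?_, ?_, ?_⟩ <;>
        · have h₁ := Nat.div_mul_le_self (x + r.length - j) p
          have h₂ := Nat.lt_div_mul_add (a := x + r.length - j) hvpos
          rw [Nat.succ_mul]
          omega
      have h₁ := hshift c y (by omega) (by omega)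
      have h₂ := hshift c (y - r.length) (by omega) (by omega)
      have h₃ := hperr (y - r.length) (by omega) (by omega)
      rw [Nat.sub_add_cancel (by omega)] at h₃
      rw [hy, h₁, h₃, ← h₂]
      congr 1
      omega
    have hlen : ((u.drop i).take (j - i + r.length)).length = (k + 1) * r.length := by
      rw [List.length_take, List.length_drop, Nat.succ_mul, ← hjk]; omega
    have hpow := eq_wordPow_of_period hlen fun x hx => by
      rw [hlen, Nat.succ_mul, ← hjk] at hx
      rw [List.getElem?_take, List.getElem?_take, List.getElem?_drop, List.getElem?_drop,
        if_pos (by omega), if_pos (by omega), ← Nat.add_assoc]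
      exact hperr' (i + x) (by omega) (by omega)
    have hroot : rootLength ((u.drop i).take (j - i + r.length)) ≤ l := by
      rw [hpow]
      refine (rootLength_wordPow_le _ (Nat.succ_pos k)).trans ?_
      rw [List.length_take]
      omega
    have := le_firstFactorLength (by rw [List.length_drop]; omega) hroot
    omega

end Cuts

/-! ### Additive Ramsey argument -/

section Ramsey

variable {K : Type*} [Fintype K]

/-- Among sufficiently many numbers there are `m` for which the color of a pair depends on the
smaller number only. -/
theorem exists_color_of_left {c : ℕ} (hc : Fintype.card K ≤ c) (col : ℕ → ℕ → K) (m : ℕ)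
    (S : Finset ℕ) (hS : (c + 1) ^ m ≤ S.card) :
    ∃ h : ℕ → K, ∃ T ⊆ S, T.card = m ∧ ∀ a ∈ T, ∀ b ∈ T, a < b → col a b = h a := by
  classical
  induction m generalizing S with
  | zero => exact ⟨fun a => col a a, ∅, by simp, rfl, by simp⟩
  | succ m ih =>
    have hne : S.Nonempty := Finset.card_pos.1 (lt_of_lt_of_le (by positivity) hS)
    set s := S.min' hne with hs
    have hsS : s ∈ S := S.min'_mem hne
    have hcard : (Finset.univ : Finset K).card * (c + 1) ^ m ≤ (S.erase s).card := by
      rw [Finset.card_erase_of_mem hsS, Finset.card_univ]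
      have h₁ : Fintype.card K * (c + 1) ^ m ≤ c * (c + 1) ^ m := Nat.mul_le_mul_right _ hc
      have h₂ : 0 < (c + 1) ^ m := by positivity
      rw [pow_succ, Nat.mul_comm, Nat.succ_mul] at hS
      omega
    obtain ⟨y, -, hy⟩ := Finset.exists_le_card_fiber_of_mul_le_card_of_maps_to
      (s := S.erase s) (t := Finset.univ) (f := col s) (fun _ _ => Finset.mem_univ _)
      ⟨col s s, Finset.mem_univ _⟩ hcard
    obtain ⟨h, T, hT, hTm, hTh⟩ := ih _ hy
    have hT' : ∀ b ∈ T, b ∈ S ∧ s < b ∧ col s b = y := by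
      intro b hb
      have h' := hT hb
      rw [Finset.mem_filter, Finset.mem_erase] at h'
      exact ⟨h'.1.2, lt_of_le_of_ne (S.min'_le b h'.1.2) (Ne.symm h'.1.1), h'.2⟩
    have hsT : s ∉ T := fun hs => (hT' s hs).2.1.false
    refine ⟨Function.update h s y, insert s T, ?_, by rw [Finset.card_insert_of_notMem hsT, hTm],
      ?_⟩
    · intro b hb
      rcases Finset.mem_insert.1 hb with rfl | hb
      · exact hsS
      · exact (hT' b hb).1
    · intro a ha b hb hab
      rcases Finset.mem_insert.1 ha with rfl | ha
      · rcases Finset.mem_insert.1 hb with rfl | hb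
        · exact absurd hab (lt_irrefl _)
        · rw [Function.update_self, (hT' b hb).2.2]
      · rcases Finset.mem_insert.1 hb with rfl | hb
        · exact absurd hab (hT' a ha).2.1.not_gt
        · rw [Function.update_of_ne (hT' a ha).2.1.ne', hTh a ha b hb hab]

/-- The length that guarantees three consecutive segments of the same color. -/
def ramseyBound (c : ℕ) : ℕ := (c + 1) ^ (3 * c + 1)

theorem exists_monochromatic {c : ℕ} (hc : Fintype.card K ≤ c) (col : ℕ → ℕ → K) :
    ∃ i₀ i₁ i₂ i₃, i₀ < i₁ ∧ i₁ < i₂ ∧ i₂ < i₃ ∧ i₃ < ramseyBound c ∧ col i₁ i₂ = col i₀ i₁ ∧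
      col i₂ i₃ = col i₀ i₁ ∧ col i₀ i₂ = col i₀ i₁ := by
  classical
  obtain ⟨h, T, hT, hTm, hTh⟩ := exists_color_of_left hc col (3 * c + 1)
    (Finset.range (ramseyBound c)) (by rw [Finset.card_range]; rfl)
  obtain ⟨y, -, hy⟩ := Finset.exists_lt_card_fiber_of_mul_lt_card_of_maps_to
    (s := T) (t := Finset.univ) (f := h) (n := 3) (fun _ _ => Finset.mem_univ _)
    (by rw [Finset.card_univ, hTm]; omega)
  set g := Finset.orderEmbOfCardLe _ (Nat.succ_le_of_lt hy)
  have hg : ∀ i, g i ∈ T ∧ h (g i) = y := fun i =>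
    Finset.mem_filter.1 (Finset.orderEmbOfCardLe_mem _ (Nat.succ_le_of_lt hy) i)
  have hcol : ∀ i j, i < j → col (g i) (g j) = y := fun i j hij => by
    rw [hTh _ (hg i).1 _ (hg j).1 (g.strictMono hij), (hg i).2]
  refine ⟨g 0, g 1, g 2, g 3, g.strictMono (by decide), g.strictMono (by decide),
    g.strictMono (by decide), Finset.mem_range.1 (hT (hg 3).1), ?_, ?_, ?_⟩ <;>
  rw [hcol _ _ (by decide), hcol _ _ (by decide)]

end Ramsey

/-! ### Paths -/

section Path

variable {Q E : Type*}

/-- The paths of a labelled transition relation. -/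
inductive Path (step : Q → E → Q → Prop) : Q → List E → Q → Prop
  | nil (p : Q) : Path step p [] p
  | cons {p q r : Q} {e : E} {es : List E} (h : step p e q) (hr : Path step q es r) :
      Path step p (e :: es) r

namespace Path

variable {step : Q → E → Q → Prop} {p q r : Q} {xs ys : List E}

theorem append (hx : Path step p xs q) (hy : Path step q ys r) : Path step p (xs ++ ys) r := by
  induction hx with
  | nil => exact hy
  | cons h _ ih => exact .cons h (ih hy)

theorem exists_of_append (h : Path step p (xs ++ ys) r) :
    ∃ q, Path step p xs q ∧ Path step q ys r := by
  induction xs generalizing p with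
  | nil => exact ⟨p, .nil p, h⟩
  | cons x xs ih =>
    cases h with
    | cons h hr =>
      obtain ⟨q, h₁, h₂⟩ := ih hr
      exact ⟨q, .cons h h₁, h₂⟩

theorem replicate (h : Path step p xs p) (n : ℕ) :
    Path step p (List.replicate n xs).flatten p := by
  induction n with
  | zero => exact .nil p
  | succ n ih => exact h.append ih

theorem exists_step (h : Path step p xs q) {x : E} (hx : x ∈ xs) : ∃ r r', step r x r' := by
  induction h with
  | nil => simp at hx
  | cons h _ ih =>
    rcases List.mem_cons.1 hx with rfl | hx
    · exact ⟨_, _, h⟩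
    · exact ih hx

theorem exists_states (h : Path step p xs q) :
    ∃ s : ℕ → Q, s 0 = p ∧ s xs.length = q ∧
      ∀ i j, i ≤ j → j ≤ xs.length → Path step (s i) ((xs.take j).drop i) (s j) := by
  induction h with
  | nil p => exact ⟨fun _ => p, rfl, rfl, fun i j _ _ => by simpa using .nil p⟩
  | @cons p q r x xs h _ ih =>
    obtain ⟨s, h₀, h₁, h₂⟩ := ih
    refine ⟨fun n => n.casesOn p s, rfl, h₁, fun i j hij hj => ?_⟩
    cases j with
    | zero =>
      obtain rfl : i = 0 := by omega
      exact .nil p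
    | succ j =>
      rw [List.length_cons] at hj
      cases i with
      | zero =>
        have := h₂ 0 j (Nat.zero_le _) (by omega)
        rw [h₀] at this
        exact .cons h this
      | succ i => exact h₂ i j (by omega) (by omega)

end Path

end Path

/-! ### Loops with idempotent flow -/

section Flow

open Subst

variable {A : Type*}

/-- Three sequences of substitutions have the same idempotent flow of variables. -/
def SameIdempotentFlow {X : Type*} (L₁ L₂ L₃ : List (Subst X A)) : Prop :=
  ∃ e : X → List X, (∀ x, varsOf (compList L₁ x) = e x) ∧ (∀ x, varsOf (compList L₂ x) = e x) ∧
    (∀ x, varsOf (compList L₃ x) = e x) ∧ ∀ x, (e x).flatMap e = e x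

/-- The flow of variables, as a table with the entries of the image of every variable. -/
def flowTable {n : ℕ} (σ : Subst (Fin n) A) : Fin n → Fin n → Option (Fin n) :=
  fun x i => (varsOf (σ x))[i.val]?

theorem varsOf_eq_of_flowTable_eq {n : ℕ} {σ τ : Subst (Fin n) A} (hσ : σ.Copyless)
    (hτ : τ.Copyless) (h : flowTable σ = flowTable τ) (x : Fin n) :
    varsOf (σ x) = varsOf (τ x) := by
  apply List.ext_getElem?
  intro i
  by_cases hi : i < n
  · exact congrFun (congrFun h x) ⟨i, hi⟩
  · have h₁ := (hσ.nodup x).length_le_card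
    have h₂ := (hτ.nodup x).length_le_card
    rw [Fintype.card_fin] at h₁ h₂
    rw [List.getElem?_eq_none (by omega), List.getElem?_eq_none (by omega)]

theorem sameIdempotentFlow {n : ℕ} {L₁ L₂ L₃ : List (Subst (Fin n) A)}
    (hc₁ : ∀ σ ∈ L₁, σ.Copyless) (hc₂ : ∀ σ ∈ L₂, σ.Copyless) (hc₃ : ∀ σ ∈ L₃, σ.Copyless)
    (h₂ : flowTable (compList L₂) = flowTable (compList L₁))
    (h₃ : flowTable (compList L₃) = flowTable (compList L₁))
    (h₁₂ : flowTable (compList (L₁ ++ L₂)) = flowTable (compList L₁)) :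
    SameIdempotentFlow L₁ L₂ L₃ := by
  have c₁ := copyless_compList hc₁
  have e₂ := varsOf_eq_of_flowTable_eq (copyless_compList hc₂) c₁ h₂
  refine ⟨fun x => varsOf (compList L₁ x), fun _ => rfl, e₂,
    varsOf_eq_of_flowTable_eq (copyless_compList hc₃) c₁ h₃, fun x => ?_⟩
  have hc : ∀ σ ∈ L₁ ++ L₂, σ.Copyless := fun σ hσ =>
    (List.mem_append.1 hσ).elim (hc₁ σ) (hc₂ σ)
  have h := varsOf_eq_of_flowTable_eq (copyless_compList hc) c₁ h₁₂ x
  rw [compList_append, varsOf_ext, e₂] at h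
  exact h

variable {Q : Type*} [Fintype Q] {n₁ n₂ : ℕ}
  {step : Q → Subst (Fin n₁) A × Subst (Fin n₂) A → Q → Prop}

theorem exists_loop {c : ℕ}
    (hcard : Fintype.card (Q × (Fin n₁ → Fin n₁ → Option (Fin n₁)) ×
      (Fin n₂ → Fin n₂ → Option (Fin n₂))) ≤ c)
    {p q : Q} {es : List (Subst (Fin n₁) A × Subst (Fin n₂) A)} (h : Path step p es q)
    (hlen : es.length = ramseyBound c) (hc₁ : ∀ e ∈ es, e.1.Copyless)
    (hc₂ : ∀ e ∈ es, e.2.Copyless) :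
    ∃ B L₁ L₂ L₃ B' r, es = B ++ L₁ ++ L₂ ++ L₃ ++ B' ∧ L₂ ≠ [] ∧ Path step p (B ++ L₁) r ∧
      Path step r L₂ r ∧ Path step r (L₃ ++ B') q ∧
      SameIdempotentFlow (L₁.map Prod.fst) (L₂.map Prod.fst) (L₃.map Prod.fst) ∧
      SameIdempotentFlow (L₁.map Prod.snd) (L₂.map Prod.snd) (L₃.map Prod.snd) := by
  obtain ⟨s, hs₀, hs₁, hs⟩ := h.exists_states
  set seg : ℕ → ℕ → List (Subst (Fin n₁) A × Subst (Fin n₂) A) :=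
    fun i j => (es.take j).drop i with hseg
  obtain ⟨i₀, i₁, i₂, i₃, h₀₁, h₁₂, h₂₃, hi₃, e₂, e₃, e₁₂⟩ := exists_monochromatic hcard fun i j =>
    (s i, flowTable (compList ((seg i j).map Prod.fst)),
      flowTable (compList ((seg i j).map Prod.snd)))
  simp only [Prod.mk.injEq] at e₂ e₃ e₁₂
  have happ : ∀ i j k, i ≤ j → j ≤ k → seg i k = seg i j ++ seg j k := by
    intro i j k hij hjk
    have h₁ : es.take j = (es.take k).take j := by rw [List.take_take, min_eq_left hjk]
    simp only [hseg]
    rw [h₁]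
    conv_lhs => rw [← List.take_append_drop j (es.take k)]
    by_cases hl : i ≤ ((es.take k).take j).length
    · rw [List.drop_append_of_le_length hl]
    · rw [List.length_take, List.length_take] at hl
      have hd : (es.take k).drop j = [] := List.drop_eq_nil_of_le (by rw [List.length_take]; omega)
      rw [hd, List.append_nil, List.append_nil]
  have hmem : ∀ i j, ∀ e ∈ seg i j, e ∈ es := fun i j e he =>
    List.mem_of_mem_take (List.mem_of_mem_drop he)
  have hm₁ : ∀ i j, ∀ σ ∈ (seg i j).map Prod.fst, σ.Copyless := fun i j σ hσ => by
    obtain ⟨e, he, rfl⟩ := List.mem_map.1 hσ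
    exact hc₁ e (hmem i j e he)
  have hm₂ : ∀ i j, ∀ σ ∈ (seg i j).map Prod.snd, σ.Copyless := fun i j σ hσ => by
    obtain ⟨e, he, rfl⟩ := List.mem_map.1 hσ
    exact hc₂ e (hmem i j e he)
  have hall : es = seg 0 es.length := by simp [hseg]
  rw [happ i₀ i₁ i₂ h₀₁.le h₁₂.le, List.map_append, List.map_append] at e₁₂
  have hr : s i₂ = s i₁ := e₃.1.trans e₂.1.symm
  refine ⟨seg 0 i₀, seg i₀ i₁, seg i₁ i₂, seg i₂ i₃, seg i₃ es.length, s i₁, ?_, ?_, ?_, ?_, ?_,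
    sameIdempotentFlow (hm₁ _ _) (hm₁ _ _) (hm₁ _ _) e₂.2.1 e₃.2.1 e₁₂.2.1,
    sameIdempotentFlow (hm₂ _ _) (hm₂ _ _) (hm₂ _ _) e₂.2.2 e₃.2.2 e₁₂.2.2⟩
  · rw [← happ _ _ _ (by omega) (by omega), ← happ _ _ _ (by omega) (by omega),
      ← happ _ _ _ (by omega) (by omega), ← happ _ _ _ (by omega) (by omega)]
    exact hall
  · refine List.ne_nil_of_length_pos ?_
    simp only [hseg, List.length_drop, List.length_take]
    omega
  · rw [← happ _ _ _ (by omega) (by omega), ← hs₀]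
    exact hs 0 i₁ (by omega) (by omega)
  · have := hs i₁ i₂ h₁₂.le (by omega)
    rwa [hr] at this
  · rw [← happ _ _ _ (by omega) (by omega), ← hr, ← hs₁]
    exact hs i₂ es.length (by omega) le_rfl

end Flow

/-! ### Letters with the time of their production -/

section Label

open Subst

variable {X A Λ : Type*}

/-- The substitution `σ` with the label `c` attached to all its letters. -/
def label (c : Λ) (σ : Subst X A) : Subst X (A × Λ) := mapLetters (fun a => (a, c)) σ

/-- Substitutions with their letters labelled by consecutive times, from `n` on. -/
def timed : ℕ → List (Subst X A) → List (Subst X (A × ℕ))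
  | _, [] => []
  | n, σ :: ls => label n σ :: timed (n + 1) ls

/-- Substitutions with their letters labelled by `false` in a first and by `true` in
a second part. -/
def colored (ls ms : List (Subst X A)) : List (Subst X (A × Bool)) :=
  ls.map (label false) ++ ms.map (label true)

/-- The map that replaces the times before `T` by `false` and the other ones by `true`. -/
def color (T : ℕ) : A × ℕ → A × Bool := Prod.map id fun k => decide (T ≤ k)

theorem timed_append (n : ℕ) (ls ms : List (Subst X A)) :
    timed n (ls ++ ms) = timed n ls ++ timed (n + ls.length) ms := by
  induction ls generalizing n with
  | nil => rfl
  | cons σ ls ih =>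
    simp only [List.cons_append, timed, ih, List.length_cons]
    rw [Nat.add_assoc, Nat.add_comm 1]

theorem exists_of_mem_timed {n : ℕ} {ls : List (Subst X A)} {σ : Subst X (A × ℕ)}
    (h : σ ∈ timed n ls) : ∃ k, n ≤ k ∧ k < n + ls.length ∧ ∃ τ ∈ ls, σ = label k τ := by
  induction ls generalizing n with
  | nil => simp [timed] at h
  | cons τ ls ih =>
    rcases List.mem_cons.1 h with rfl | h
    · exact ⟨n, le_rfl, by simp, τ, by simp, rfl⟩
    · obtain ⟨k, h₁, h₂, τ', h₃, h₄⟩ := ih h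
      exact ⟨k, by omega, by simp only [List.length_cons]; omega, τ', by simp [h₃], h₄⟩

theorem timed_copyless {n : ℕ} {ls : List (Subst X A)} (h : ∀ σ ∈ ls, σ.Copyless) :
    ∀ σ ∈ timed n ls, σ.Copyless := by
  intro σ hσ
  obtain ⟨k, _, _, τ, hτ, rfl⟩ := exists_of_mem_timed hσ
  exact (h τ hτ).mapLetters _

theorem mem_lettersOf_label {c : Λ} {σ : Subst X A} {x : X} {a : A × Λ}
    (h : a ∈ lettersOf (label c σ x)) : a.2 = c := by
  rw [label, mapLetters, lettersOf_map, List.mem_map] at h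
  obtain ⟨b, _, rfl⟩ := h
  rfl

theorem map_label {B : Type*} (g : A × Λ → B) (c : Λ) (σ : Subst X A) :
    mapLetters g (label c σ) = mapLetters (fun a => g (a, c)) σ :=
  mapLetters_mapLetters _ _ _

theorem mapLetters_id (σ : Subst X A) : mapLetters (fun a => a) σ = σ := by
  funext x
  have : (Sum.map id fun a => a : X ⊕ A → X ⊕ A) = id := Sum.map_id_id
  simp [mapLetters, this]

theorem map_fst_timed (n : ℕ) (ls : List (Subst X A)) :
    (timed n ls).map (mapLetters Prod.fst) = ls := by
  induction ls generalizing n with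
  | nil => rfl
  | cons σ ls ih => simp [timed, ih, map_label, mapLetters_id]

theorem map_fst_label (c : Λ) (ls : List (Subst X A)) :
    (ls.map (label c)).map (mapLetters Prod.fst) = ls := by
  induction ls with
  | nil => rfl
  | cons σ ls ih => simp only [List.map_cons, ih, map_label, mapLetters_id]

theorem map_color_timed {T n : ℕ} {ls : List (Subst X A)} (h : n + ls.length ≤ T) :
    (timed n ls).map (mapLetters (color T)) = ls.map (label false) := by
  induction ls generalizing n with
  | nil => rfl
  | cons σ ls ih =>
    rw [List.length_cons] at h
    have h' : ¬ T ≤ n := by omega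
    rw [timed, List.map_cons, ih (by omega), map_label, List.map_cons]
    simp only [color, Prod.map, id, h', decide_false]
    rfl

theorem map_color_label (T : ℕ) (ls : List (Subst X A)) :
    (ls.map (label T)).map (mapLetters (color T)) = ls.map (label true) := by
  rw [List.map_map]
  refine List.map_congr_left fun σ _ => ?_
  simp only [Function.comp, map_label, color, Prod.map, id, le_refl, decide_true]
  rfl

theorem map_color_out (O : X) (ls ms : List (Subst X A)) :
    (out O (timed 0 ls ++ ms.map (label ls.length))).map (color ls.length) =
      out O (colored ls ms) := by
  rw [← out_map, List.map_append, map_color_timed (by omega), map_color_label]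
  rfl

theorem varsOf_compList_timed (n : ℕ) (ls : List (Subst X A)) (x : X) :
    varsOf (compList (timed n ls) x) = varsOf (compList ls x) := by
  conv_rhs => rw [← map_fst_timed n ls, compList_map]
  exact (varsOf_map _ _).symm

theorem sum_size_timed [Fintype X] (n : ℕ) (ls : List (Subst X A)) :
    ((timed n ls).map size).sum = (ls.map size).sum := by
  induction ls generalizing n with
  | nil => rfl
  | cons σ ls ih => simp [timed, ih, label, size_mapLetters]

/-- The pumping of a loop, with all letters labelled by the time of their production in the
original sequence. -/
theorem exists_fam [Fintype X] (O : X) {l : ℕ} {ls ms pre L₁ L₂ L₃ post : List (Subst X A)}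
    (hls : ls = pre ++ L₁ ++ L₂ ++ L₃ ++ post) (hc : ∀ σ ∈ ls, σ.Copyless)
    (hflow : SameIdempotentFlow L₁ L₂ L₃) (hl : 2 * (L₂.map size).sum ≤ l) :
    ∃ f, Fam (fun a : A × ℕ => pre.length ≤ a.2 ∧ a.2 < pre.length + (L₁ ++ L₂ ++ L₃).length) l f ∧
      f 1 = out O (timed 0 ls ++ ms.map (label ls.length)) ∧
      (∀ n, (f n).map Prod.fst =
        out O (pre ++ L₁ ++ (List.replicate n L₂).flatten ++ L₃ ++ post ++ ms)) ∧
      (f 0).map (color ls.length) = out O (colored (pre ++ L₁ ++ L₃ ++ post) ms) := by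
  obtain ⟨e, h₁, h₂, h₃, he⟩ := hflow
  set N₁ := pre.length
  set N₂ := N₁ + L₁.length with hN₂
  set N₃ := N₂ + L₂.length with hN₃
  set N₄ := N₃ + L₃.length with hN₄
  have hlen : ls.length = N₄ + post.length := by
    rw [hls]; simp only [List.length_append]; omega
  have hlen' : (L₁ ++ L₂ ++ L₃).length = L₁.length + L₂.length + L₃.length := by
    simp only [List.length_append]
  refine ⟨_, fam_out (e := e) O (timed 0 pre) (timed N₁ L₁) (timed N₂ L₂) (timed N₃ L₃)
    (timed N₄ post ++ ms.map (label ls.length))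
    (timed_copyless fun σ hσ => hc σ (by simp [hls, hσ]))
    (timed_copyless fun σ hσ => hc σ (by simp [hls, hσ])) (by simpa only [varsOf_compList_timed])
    (by simpa only [varsOf_compList_timed]) (by simpa only [varsOf_compList_timed]) he ?_
    (by rwa [sum_size_timed]), ?_, fun n => ?_, ?_⟩
  · intro σ hσ x a ha
    rw [List.mem_append, List.mem_append] at hσ
    rcases hσ with (hσ | hσ) | hσ <;>
    · obtain ⟨k, hk₁, hk₂, τ, _, rfl⟩ := exists_of_mem_timed hσ
      rw [mem_lettersOf_label ha]
      omega
  · congr 1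
    rw [hls]
    simp only [timed_append, List.append_assoc, List.length_append, Nat.zero_add,
      List.replicate_one, List.flatten_singleton]
    simp only [N₁, N₂, N₃, N₄, Nat.add_assoc]
  · rw [← out_map]
    simp only [List.map_append, map_fst_timed, map_fst_label, List.map_flatten, List.map_replicate,
      List.append_assoc]
  · rw [← out_map]
    simp only [List.map_append, List.replicate_zero, List.flatten_nil,
      List.append_nil, map_color_label]
    rw [map_color_timed (by omega), map_color_timed (by omega), map_color_timed (by omega),
      map_color_timed (by omega)]
    simp only [colored, List.map_append, List.append_assoc]

theorem countP_false_colored_le [Fintype X] (O : X) {ls ms : List (Subst X A)} {M : ℕ}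
    (hls : ∀ σ ∈ ls, σ.Copyless) (hms : ∀ σ ∈ ms, σ.Copyless) (hM : ∀ σ ∈ ls, size σ ≤ M) :
    (out O (colored ls ms)).countP (fun a => !a.2) ≤ M * ls.length := by
  have hc : ∀ σ ∈ colored ls ms, σ.Copyless := by
    intro σ hσ
    rcases List.mem_append.1 hσ with h | h <;> obtain ⟨τ, hτ, rfl⟩ := List.mem_map.1 h
    · exact (hls τ hτ).mapLetters _
    · exact (hms τ hτ).mapLetters _
  refine (countP_out_le _ O hc).trans ?_
  have h₁ : ((ms.map (label true)).map
      (letterCount fun a : A × Bool => !a.2)).sum = 0 := by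
    rw [List.map_map, List.sum_eq_zero]
    intro k hk
    obtain ⟨σ, _, rfl⟩ := List.mem_map.1 hk
    rw [Function.comp, label, letterCount_mapLetters]
    simp [letterCount]
  rw [colored, List.map_append, List.sum_append, h₁, Nat.add_zero, List.map_map]
  refine (List.sum_le_card_nsmul _ M ?_).trans (by simp [Nat.mul_comm])
  intro k hk
  obtain ⟨σ, hσ, rfl⟩ := List.mem_map.1 hk
  rw [Function.comp, label, letterCount_mapLetters]
  exact hM σ hσ

end Label

/-! ### Removal of loops -/

section Removal

variable {A Q : Type*} {n₁ n₂ : ℕ}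
  {step : Q → Subst (Fin n₁) A × Subst (Fin n₂) A → Q → Prop}

theorem map_eq_append₃ {α β : Type*} {g : α → β} {x : List α} {u w v : List β}
    (h : x.map g = u ++ w ++ v) :
    ∃ u' w' v', x = u' ++ w' ++ v' ∧ u'.map g = u ∧ w'.map g = w ∧ v'.map g = v := by
  obtain ⟨y, v', rfl, hy, hv⟩ := List.map_eq_append_iff.1 h
  obtain ⟨u', w', rfl, hu, hw⟩ := List.map_eq_append_iff.1 hy
  exact ⟨u', w', v', rfl, hu, hw, hv⟩

/-- Some block of `R` consecutive times is avoided by at most `c` given times, among the first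
`c + 1` blocks. -/
theorem exists_avoided_block (R c : ℕ) (ts : List ℕ) (h : ts.length ≤ c) :
    ∃ m ≤ c, ∀ t ∈ ts, ¬ (m * R ≤ t ∧ t < m * R + R) := by
  classical
  obtain ⟨m, hm, hmt⟩ := Finset.exists_mem_notMem_of_card_lt_card
    (s := (ts.map (· / R)).toFinset) (t := Finset.range (c + 1)) (by
      rw [Finset.card_range]
      have := (ts.map (· / R)).toFinset_card_le
      rw [List.length_map] at this
      omega)
  refine ⟨m, Nat.lt_succ_iff.1 (Finset.mem_range.1 hm), fun t ht hmR => hmt ?_⟩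
  rw [List.mem_toFinset, List.mem_map]
  refine ⟨t, ht, Nat.div_eq_of_lt_le hmR.1 ?_⟩
  rw [Nat.succ_mul]
  exact hmR.2

theorem sum_size_le {X : Type*} [Fintype X] {M : ℕ} {L : List (Subst X A)}
    (h : ∀ σ ∈ L, size σ ≤ M) :
    (L.map size).sum ≤ M * L.length := by
  refine (List.sum_le_card_nsmul _ M ?_).trans (by simp [Nat.mul_comm])
  intro k hk
  obtain ⟨σ, hσ, rfl⟩ := List.mem_map.1 hk
  exact h σ hσ

/-- The weights of two runs on the same input, at a position inside of a common factor that is not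
repetitive or lies at an end of the output, differ by a bounded amount.  The letters with label
`false` are those produced up to the time at which the weights are taken.  In a long run there is
a loop before this time that produces no letter of the common factor; as the outputs
agree however often the loop is repeated, the removal of the loop does not change the
difference. -/
theorem weight_diff_le [Fintype Q] {c M l C : ℕ} {p q : Q} (O₁ : Fin n₁) (O₂ : Fin n₂)
    {ms₁ : List (Subst (Fin n₁) A)} {ms₂ : List (Subst (Fin n₂) A)}
    (hcard : Fintype.card (Q × (Fin n₁ → Fin n₁ → Option (Fin n₁)) ×
      (Fin n₂ → Fin n₂ → Option (Fin n₂))) ≤ c)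
    (hl : 2 * (M * ramseyBound c) ≤ l)
    (hstep : ∀ r e r', step r e r' → (e.1.Copyless ∧ size e.1 ≤ M) ∧ e.2.Copyless ∧ size e.2 ≤ M)
    (hms₁ : ∀ σ ∈ ms₁, σ.Copyless) (hms₂ : ∀ σ ∈ ms₂, σ.Copyless)
    (hout : ∀ es, Path step p es q →
      out O₁ (es.map Prod.fst ++ ms₁) = out O₂ (es.map Prod.snd ++ ms₂))
    (t : ℕ) (es : List (Subst (Fin n₁) A × Subst (Fin n₂) A)) (ht : es.length = t)
    (hes : Path step p es q) (u₁ w u₂ z₁ w' z₂ : List (A × Bool))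
    (h₁ : out O₁ (colored (es.map Prod.fst) ms₁) = u₁ ++ w ++ u₂)
    (h₂ : out O₂ (colored (es.map Prod.snd) ms₂) = z₁ ++ w' ++ z₂)
    (huz : u₁.length = z₁.length) (hww : w.length = w'.length) (hwC : w.length ≤ C) (hw : w ≠ [])
    (hbreak : ¬ Repetitive l (w.map Prod.fst) ∨ u₁ = [] ∨ u₂ = []) (i : ℕ) (hi : i ≤ w.length) :
    (((u₁ ++ w.take i).countP Prod.snd : ℤ) - (z₁ ++ w'.take i).countP Prod.snd).natAbs ≤
      M * ((2 * C + 1) * ramseyBound c) := by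
  -- removing a loop shortens the first part, and keeps `w`, `w'` and the two counts
  induction t using Nat.strong_induction_on generalizing es u₁ u₂ z₁ z₂ with
  | _ t ih =>
  have hc₁ : ∀ σ ∈ es.map Prod.fst, σ.Copyless ∧ size σ ≤ M := by
    intro σ hσ
    obtain ⟨e, he, rfl⟩ := List.mem_map.1 hσ
    obtain ⟨r, r', hr⟩ := hes.exists_step he
    exact (hstep r e r' hr).1
  have hc₂ : ∀ σ ∈ es.map Prod.snd, σ.Copyless ∧ size σ ≤ M := by
    intro σ hσ
    obtain ⟨e, he, rfl⟩ := List.mem_map.1 hσ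
    obtain ⟨r, r', hr⟩ := hes.exists_step he
    exact (hstep r e r' hr).2
  set R := ramseyBound c with hR
  by_cases hlt : t < (2 * C + 1) * R
  · -- few letters are produced in the first part
    have hb₁ := countP_false_colored_le O₁ (fun σ hσ => (hc₁ σ hσ).1) hms₁ fun σ hσ => (hc₁ σ hσ).2
    have hb₂ := countP_false_colored_le O₂ (fun σ hσ => (hc₂ σ hσ).1) hms₂ fun σ hσ => (hc₂ σ hσ).2
    rw [h₁, List.length_map, ht] at hb₁
    rw [h₂, List.length_map, ht] at hb₂
    have hMt : M * t ≤ M * ((2 * C + 1) * R) := Nat.mul_le_mul_left _ hlt.le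
    have hpre : ∀ (i : ℕ) (u w v : List (A × Bool)),
        (u ++ w.take i).countP (fun a => !a.2) ≤ (u ++ w ++ v).countP fun a => !a.2 := by
      intro i u w v
      refine List.Sublist.countP_le ?_
      rw [List.append_assoc]
      exact (((List.take_prefix i w).sublist.trans (List.prefix_append w v).sublist)).append_left u
    have hs₁ := (u₁ ++ w.take i).length_eq_countP_add_countP Prod.snd
    have hs₂ := (z₁ ++ w'.take i).length_eq_countP_add_countP Prod.snd
    have hp₁ := hpre i u₁ w u₂
    have hp₂ := hpre i z₁ w' z₂
    rw [List.length_append, List.length_take, min_eq_left hi] at hs₁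
    rw [List.length_append, List.length_take, min_eq_left (hww ▸ hi)] at hs₂
    simp only [Bool.not_eq_true, Bool.decide_eq_false] at hs₁ hs₂
    omega
  · push Not at hlt
    -- the letters with the times of their production
    rw [← map_color_out] at h₁ h₂
    obtain ⟨U₁, W, U₂, hx₁, hU₁, hW, hU₂⟩ := map_eq_append₃ h₁
    obtain ⟨Z₁, W', Z₂, hx₂, hZ₁, hW', hZ₂⟩ := map_eq_append₃ h₂
    obtain ⟨m, hm, hmt⟩ := exists_avoided_block R (2 * C) ((W ++ W').map Prod.snd) (by
      rw [← hW, List.length_map] at hwC hww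
      rw [← hW', List.length_map] at hww
      rw [List.length_map, List.length_append]
      omega)
    -- a loop inside of the avoided block
    have hmR : m * R + R ≤ t := by
      have := Nat.mul_le_mul_right R (Nat.succ_le_succ hm)
      rw [Nat.succ_mul] at this
      exact this.trans hlt
    have hsplit : es = es.take (m * R) ++ ((es.drop (m * R)).take R ++
        (es.drop (m * R)).drop R) := by
      rw [List.take_append_drop, List.take_append_drop]
    set E := es.take (m * R) with hE
    set E' := (es.drop (m * R)).drop R
    have hElen : E.length = m * R := by rw [hE, List.length_take]; omega
    rw [hsplit] at hes
    obtain ⟨r₁, hp₁, hp'⟩ := hes.exists_of_append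
    obtain ⟨r₂, hp₂, hp₃⟩ := hp'.exists_of_append
    have hmemseg : ∀ e ∈ (es.drop (m * R)).take R, e ∈ es := fun e he =>
      List.mem_of_mem_drop (List.mem_of_mem_take he)
    have hseglen : ((es.drop (m * R)).take R).length = R := by
      rw [List.length_take, List.length_drop]; omega
    obtain ⟨B, L₁, L₂, L₃, B', r, hB, hL₂, hq₁, hq₂, hq₃, hflow₁, hflow₂⟩ :=
      exists_loop hcard hp₂ hseglen
        (fun e he => (hc₁ _ (List.mem_map_of_mem (hmemseg e he))).1)
        (fun e he => (hc₂ _ (List.mem_map_of_mem (hmemseg e he))).1)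
    rw [hB] at hsplit hseglen
    simp only [List.length_append] at hseglen
    have hmemL₂ : ∀ e ∈ L₂, e ∈ es := fun e he => by rw [hsplit]; simp [he]
    have hpump : ∀ n, Path step p (E ++ B ++ L₁ ++ (List.replicate n L₂).flatten ++ L₃ ++
        (B' ++ E')) q := by
      intro n
      have := hp₁.append (hq₁.append ((hq₂.replicate n).append (hq₃.append hp₃)))
      simpa only [List.append_assoc] using this
    have hsz : ∀ k, k ≤ M * L₂.length → 2 * k ≤ l := by
      intro k hk
      have : M * L₂.length ≤ M * R := Nat.mul_le_mul_left _ (by omega)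
      omega
    have hls₁ : es.map Prod.fst = (E ++ B).map Prod.fst ++ L₁.map Prod.fst ++ L₂.map Prod.fst ++
        L₃.map Prod.fst ++ (B' ++ E').map Prod.fst := by
      simp only [← List.map_append]
      rw [hsplit]
      simp only [List.append_assoc]
    have hls₂ : es.map Prod.snd = (E ++ B).map Prod.snd ++ L₁.map Prod.snd ++ L₂.map Prod.snd ++
        L₃.map Prod.snd ++ (B' ++ E').map Prod.snd := by
      simp only [← List.map_append]
      rw [hsplit]
      simp only [List.append_assoc]
    obtain ⟨f, hf, hf₁, hfn, hf₀⟩ := exists_fam (l := l) (ms := ms₁) O₁ hls₁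
      (fun σ hσ => (hc₁ σ hσ).1) hflow₁ (hsz _ (by
        simpa using sum_size_le (L := L₂.map Prod.fst) (M := M) fun σ hσ => by
          obtain ⟨e, he, rfl⟩ := List.mem_map.1 hσ
          exact (hc₁ _ (List.mem_map_of_mem (hmemL₂ e he))).2))
    obtain ⟨g, hg, hg₁, hgn, hg₀⟩ := exists_fam (l := l) (ms := ms₂) O₂ hls₂
      (fun σ hσ => (hc₂ σ hσ).1) hflow₂ (hsz _ (by
        simpa using sum_size_le (L := L₂.map Prod.snd) (M := M) fun σ hσ => by
          obtain ⟨e, he, rfl⟩ := List.mem_map.1 hσ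
          exact (hc₂ _ (List.mem_map_of_mem (hmemL₂ e he))).2))
    have hloop : ∀ a ∈ W ++ W', ¬ (m * R + B.length ≤ a.2 ∧
        a.2 < m * R + B.length + (L₁.length + L₂.length + L₃.length)) := by
      intro a ha hlt
      exact hmt a.2 (List.mem_map_of_mem ha) ⟨by omega, by omega⟩
    simp only [List.length_map, List.length_append, hElen] at hf hg
    have hfg : ∀ n, (f n).map Prod.fst = (g n).map Prod.fst := by
      intro n
      rw [hfn, hgn]
      have := hout _ (hpump n)
      simpa only [List.map_append, List.map_flatten, List.map_replicate] using this
    obtain ⟨f₁, f₂, hf₁', hf₂', hfU₁, hfU₂, hfs⟩ := hf.split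
      (fun a ha => hloop a (List.mem_append_left _ ha))
      (by rintro rfl; exact hw hW.symm) (hf₁.trans hx₁)
    obtain ⟨g₁, g₂, hg₁', hg₂', hgZ₁, hgZ₂, hgs⟩ := hg.split
      (fun a ha => hloop a (List.mem_append_right _ ha))
      (by
        rintro rfl
        rw [← hW'] at hww
        exact hw (List.length_eq_zero_iff.1 hww)) (hg₁.trans hx₂)
    have hpos : (f₁ 0).length = (g₁ 0).length := by
      refine hf₁'.position_eq (w := W) (w' := W') (π := Prod.fst) hf₂' hg₁' hg₂'
        (fun n => by rw [← hfs, ← hgs, hfg]) ?_ ?_ ?_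
      · rw [hfU₁, hgZ₁]
        rwa [← hU₁, ← hZ₁, List.length_map, List.length_map] at huz
      · rwa [← hW, ← hW', List.length_map, List.length_map] at hww
      · rw [hfU₁, hfU₂]
        rw [← hW, List.map_map, ← hU₁, ← hU₂, List.map_eq_nil_iff, List.map_eq_nil_iff] at hbreak
        exact hbreak
    -- letters of the second part are not affected
    have hcount : ∀ {F : ℕ → List (A × ℕ)} {a b s : ℕ}, b ≤ s →
        Fam (fun x : A × ℕ => a ≤ x.2 ∧ x.2 < b) l F →
        ((F 0).map (color s)).countP Prod.snd = ((F 1).map (color s)).countP Prod.snd := by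
      intro F a b s hb hF
      rw [List.countP_map, List.countP_map]
      refine hF.countP_eq (fun x hx => ?_) 0
      simp only [Function.comp, color, Prod.map, decide_eq_false_iff_not]
      omega
    have hbt : m * R + B.length + (L₁.length + L₂.length + L₃.length) ≤ es.length := by omega
    have hpath := hpump 0
    have h₁' := hf₀
    rw [hfs, List.map_append, List.map_append, hW] at h₁'
    have h₂' := hg₀
    rw [hgs, List.map_append, List.map_append, hW'] at h₂'
    simp only [List.length_map, ← List.map_append] at h₁' h₂'
    simp only [List.replicate_zero, List.flatten_nil, List.append_nil] at hpath
    have hL₂pos := List.length_pos_iff.2 hL₂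
    have hlen := congrArg List.length hsplit
    simp only [List.length_append] at hlen
    have key := ih _ (by
      simp only [List.length_append]
      omega) _ rfl hpath _ _ _ _ h₁'.symm h₂'.symm (by simpa using hpos) (by
        rcases hbreak with h | h | h
        · exact Or.inl h
        · refine Or.inr (Or.inl ?_)
          rw [← hU₁, List.map_eq_nil_iff] at h
          rw [hf₁'.eq_nil (hfU₁.trans h), List.map_nil]
        · refine Or.inr (Or.inr ?_)
          rw [← hU₂, List.map_eq_nil_iff] at h
          rw [hf₂'.eq_nil (hfU₂.trans h), List.map_nil])
    rw [List.countP_append, List.countP_append, hcount hbt hf₁', hcount hbt hg₁', hfU₁, hgZ₁] at key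
    rw [List.length_map] at hU₁ hZ₁
    rwa [hU₁, hZ₁, ← List.countP_append, ← List.countP_append] at key

end Removal

/-! ### The delay of runs with the same input -/

section Weight

open Subst

variable {X A : Type*}

theorem map_fst_out_colored (O : X) (ls ms : List (Subst X A)) :
    (out O (colored ls ms)).map Prod.fst = out O (ls ++ ms) := by
  rw [← out_map, colored, List.map_append, map_fst_label, map_fst_label]

theorem weight_eq_countP (O : X) (j t : ℕ) (ls : List (Subst X A)) :
    weight O j t ls =
      ((out O (colored (ls.take t) (ls.drop t))).take j).countP fun a => !a.2 := by
  have h : (ls.mapIdx fun i σ => relabel (i + 1) σ).map (mapLetters fun i => decide (i ≤ t)) =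
      (colored (ls.take t) (ls.drop t)).map (mapLetters fun a => !a.2) := by
    apply List.ext_getElem
    · simp [colored]; omega
    · intro i h₁ h₂
      have hrel : ∀ (i : ℕ) (σ : Subst X A), mapLetters (fun i => decide (i ≤ t))
          (relabel (i + 1) σ) = mapLetters (fun _ => decide (i + 1 ≤ t)) σ :=
        fun i σ => mapLetters_mapLetters _ _ _
      simp only [List.length_map, List.length_mapIdx] at h₁
      simp only [List.getElem_map, List.getElem_mapIdx, hrel, colored, List.getElem_append,
        List.length_map, List.length_take]
      split_ifs with hi
      · have hit : i + 1 ≤ t := by omega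
        simp [map_label, hit]
      · have hit : ¬ i + 1 ≤ t := by omega
        have hmin : min t ls.length = t := by omega
        have ht : t + (i - t) = i := by omega
        simp [map_label, hit, hmin, ht]
  have h' := congrArg (out O) h
  rw [out_map, out_map] at h'
  have hcount : ∀ (w : List ℕ), (w.take j).countP (fun i => decide (i ≤ t)) =
      ((w.map fun i => decide (i ≤ t)).take j).countP id := fun w => by
    rw [← List.map_take, List.countP_map]; rfl
  rw [weight, origins, hcount, h', ← List.map_take, List.countP_map]
  rfl

/-- At a position of the output, the letters that are produced up to time `t` and those
that are produced later add up. -/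
theorem weight_add_countP (O : X) {j : ℕ} (t : ℕ) {ls : List (Subst X A)}
    (hj : j ≤ (out O ls).length) :
    weight O j t ls +
      ((out O (colored (ls.take t) (ls.drop t))).take j).countP Prod.snd = j := by
  have hlen := congrArg List.length (map_fst_out_colored O (ls.take t) (ls.drop t))
  rw [List.length_map, List.take_append_drop] at hlen
  have h := ((out O (colored (ls.take t) (ls.drop t))).take j).length_eq_countP_add_countP Prod.snd
  simp only [Bool.not_eq_true, Bool.decide_eq_false] at h
  rw [List.length_take, hlen, min_eq_left hj] at h
  rw [weight_eq_countP]
  omega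

theorem weight_of_length_le (O : X) {j t : ℕ} {ls : List (Subst X A)}
    (hj : j ≤ (out O ls).length) (ht : ls.length ≤ t) : weight O j t ls = j := by
  have h := weight_add_countP O t hj
  rw [List.take_of_length_le ht, List.drop_eq_nil_of_le ht] at h
  have h₀ : out O (colored ls []) = (out O ls).map fun a => (a, false) := by
    rw [← out_map]
    simp only [colored, List.map_nil, List.append_nil]
    rfl
  rw [h₀, ← List.map_take, List.countP_map] at h
  simpa [Function.comp_def] using h

end Weight

section Runs

variable {A : Type*} {n₁ x₁ n₂ x₂ : ℕ}
  {T₁ : SST A (Fin n₁) (Fin x₁)} {T₂ : SST A (Fin n₂) (Fin x₂)}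

/-- Simultaneous transitions of two transducers that read the same letter. -/
def jointStep (T₁ : SST A (Fin n₁) (Fin x₁)) (T₂ : SST A (Fin n₂) (Fin x₂))
    (p : Fin n₁ × Fin n₂) (e : Subst (Fin x₁) A × Subst (Fin x₂) A) (q : Fin n₁ × Fin n₂) : Prop :=
  ∃ (a : A) (h₁ : (p.1, a, q.1) ∈ T₁.trans) (h₂ : (p.2, a, q.2) ∈ T₂.trans),
    e = (T₁.κ ⟨_, h₁⟩, T₂.κ ⟨_, h₂⟩)

theorem exists_path_of_run {p₁ q₁ : Fin n₁} {p₂ q₂ : Fin n₂} {u : List A}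
    {ls : List (Subst (Fin x₁) A)} {ms : List (Subst (Fin x₂) A)} (h₁ : T₁.Run p₁ u ls q₁)
    (h₂ : T₂.Run p₂ u ms q₂) :
    ∃ es, Path (jointStep T₁ T₂) (p₁, p₂) es (q₁, q₂) ∧ es.map Prod.fst = ls ∧
      es.map Prod.snd = ms := by
  induction h₁ generalizing p₂ ms with
  | nil =>
    cases h₂
    exact ⟨[], .nil _, rfl, rfl⟩
  | cons h _ ih =>
    cases h₂ with
    | cons h' hr' =>
      obtain ⟨es, he, rfl, rfl⟩ := ih hr'
      exact ⟨_, .cons ⟨_, h, h', rfl⟩ he, rfl, rfl⟩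

theorem exists_run_of_path {p q : Fin n₁ × Fin n₂} {es : List (Subst (Fin x₁) A × Subst (Fin x₂) A)}
    (h : Path (jointStep T₁ T₂) p es q) :
    ∃ u, T₁.Run p.1 u (es.map Prod.fst) q.1 ∧ T₂.Run p.2 u (es.map Prod.snd) q.2 := by
  induction h with
  | nil => exact ⟨[], .nil _, .nil _⟩
  | cons h _ ih =>
    obtain ⟨u, h₁, h₂⟩ := ih
    obtain ⟨a, h₁', h₂', rfl⟩ := h
    exact ⟨a :: u, .cons h₁' h₁, .cons h₂' h₂⟩

theorem length_of_run {T : SST A (Fin n₁) (Fin x₁)} {p q : Fin n₁} {u : List A}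
    {ls : List (Subst (Fin x₁) A)} (h : T.Run p u ls q) : ls.length = u.length := by
  induction h with
  | nil => rfl
  | cons _ _ ih => simp [ih]

theorem length_of_mem_lang {T : SST A (Fin n₁) (Fin x₁)} {u : List A}
    {ls : List (Subst (Fin x₁) A)} (h : (u, ls) ∈ T.lang) : ls.length = u.length + 1 := by
  obtain ⟨_, _, _, _, ls, hr, rfl⟩ := h
  simp [length_of_run hr]

theorem mem_range_of_run {T : SST A (Fin n₁) (Fin x₁)} {p q : Fin n₁} {u : List A}
    {ls : List (Subst (Fin x₁) A)} (h : T.Run p u ls q) : ∀ σ ∈ ls, σ ∈ Set.range T.κ := by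
  induction h with
  | nil => simp
  | cons h _ ih =>
    intro σ hσ
    rcases List.mem_cons.1 hσ with rfl | hσ
    · exact ⟨_, rfl⟩
    · exact ih σ hσ

theorem mem_substs_of_mem_lang {T : SST A (Fin n₁) (Fin x₁)} {u : List A}
    {ls : List (Subst (Fin x₁) A)} (h : (u, ls) ∈ T.lang) : ∀ σ ∈ ls, σ ∈ T.substs := by
  obtain ⟨_, _, q, _, ls, hr, rfl⟩ := h
  intro σ hσ
  rcases List.mem_append.1 hσ with hσ | hσ
  · exact Or.inl (mem_range_of_run hr σ hσ)
  · exact Or.inr ⟨q, (List.mem_singleton.1 hσ).symm⟩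

/-- If the outputs of two transducers agree on all pairs of runs with the same input, then the delay
of all these pairs is bounded. -/
theorem delay_le {c M l : ℕ}
    (hcard : Fintype.card ((Fin n₁ × Fin n₂) × (Fin x₁ → Fin x₁ → Option (Fin x₁)) ×
      (Fin x₂ → Fin x₂ → Option (Fin x₂))) ≤ c)
    (hl : 2 * (M * ramseyBound c) ≤ l) (hpos : 0 < l)
    (hM₁ : ∀ e, size (T₁.κ e) ≤ M) (hM₂ : ∀ e, size (T₂.κ e) ≤ M)
    (heq : ∀ u ls ms, (u, ls) ∈ T₁.lang → (u, ms) ∈ T₂.lang → out T₁.O ls = out T₂.O ms)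
    {u : List A} {ls : List (Subst (Fin x₁) A)} {ms : List (Subst (Fin x₂) A)}
    (hls : (u, ls) ∈ T₁.lang) (hms : (u, ms) ∈ T₂.lang) :
    delay T₁.O T₂.O l ls ms ≤ M * ((2 * (3 * l) + 1) * ramseyBound c) := by
  refine Finset.sup_le fun j hj => Finset.sup_le fun t _ => ?_
  have hout := heq u ls ms hls hms
  obtain ⟨_, _, hj₀, hj₁⟩ := exists_of_mem_cuts hj
  have hjpos : 0 < j := by omega
  have hlen₁ := length_of_mem_lang hls
  have hlen₂ := length_of_mem_lang hms
  have hw₁ := weight_add_countP T₁.O t hj₁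
  have hw₂ := weight_add_countP T₂.O t (hout ▸ hj₁)
  -- at the time of the final substitution, both weights are `j`
  by_cases ht : ls.length ≤ t
  · rw [diff, weight_of_length_le T₁.O hj₁ ht,
      weight_of_length_le T₂.O (hout ▸ hj₁) (by omega), sub_self]
    exact Nat.zero_le _
  obtain ⟨p₁, hp₁, q₁, hq₁, ls, hr₁, rfl⟩ := hls
  obtain ⟨p₂, hp₂, q₂, hq₂, ms, hr₂, rfl⟩ := hms
  obtain ⟨es, hes, rfl, rfl⟩ := exists_path_of_run hr₁ hr₂
  rw [List.length_append, List.length_map, List.length_singleton] at ht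
  have hte : t ≤ es.length := by omega
  have hes' := hes
  rw [← List.take_append_drop t es] at hes'
  obtain ⟨q, hpq, hqq⟩ := hes'.exists_of_append
  have htd₁ : ∀ σ : Subst (Fin x₁) A, (es.map Prod.fst ++ [σ]).take t = (es.take t).map Prod.fst ∧
      (es.map Prod.fst ++ [σ]).drop t = (es.drop t).map Prod.fst ++ [σ] := fun σ => by
    rw [List.take_append_of_le_length (by simpa), List.drop_append_of_le_length (by simpa),
      List.map_take, List.map_drop]
    exact ⟨rfl, rfl⟩
  have htd₂ : ∀ σ : Subst (Fin x₂) A, (es.map Prod.snd ++ [σ]).take t = (es.take t).map Prod.snd ∧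
      (es.map Prod.snd ++ [σ]).drop t = (es.drop t).map Prod.snd ++ [σ] := fun σ => by
    rw [List.take_append_of_le_length (by simpa), List.drop_append_of_le_length (by simpa),
      List.map_take, List.map_drop]
    exact ⟨rfl, rfl⟩
  have hf₁ := map_fst_out_colored T₁.O ((es.map Prod.fst ++ [T₁.κF q₁]).take t)
    ((es.map Prod.fst ++ [T₁.κF q₁]).drop t)
  have hf₂ := map_fst_out_colored T₂.O ((es.map Prod.snd ++ [T₂.κF q₂]).take t)
    ((es.map Prod.snd ++ [T₂.κF q₂]).drop t)
  rw [List.take_append_drop] at hf₁ hf₂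
  rw [(htd₁ _).1, (htd₁ _).2] at hw₁ hf₁
  rw [(htd₂ _).1, (htd₂ _).2] at hw₂ hf₂
  set Y₁ := out T₁.O (colored ((es.take t).map Prod.fst)
    ((es.drop t).map Prod.fst ++ [T₁.κF q₁])) with hY₁
  set Y₂ := out T₂.O (colored ((es.take t).map Prod.snd)
    ((es.drop t).map Prod.snd ++ [T₂.κF q₂])) with hY₂
  set v := out T₁.O (es.map Prod.fst ++ [T₁.κF q₁]) with hv
  have hlY₁ : Y₁.length = v.length := by rw [← hf₁, List.length_map]
  have hlY₂ : Y₂.length = v.length := by rw [hout, ← hf₂, List.length_map]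
  have hstep : ∀ r e r', jointStep T₁ T₂ r e r' →
      (e.1.Copyless ∧ size e.1 ≤ M) ∧ e.2.Copyless ∧ size e.2 ≤ M := by
    rintro r e r' ⟨a, h₁, h₂, rfl⟩
    exact ⟨⟨T₁.copyless _, hM₁ _⟩, T₂.copyless _, hM₂ _⟩
  -- the part of the output from `j - 2 * l` to `j + l`
  set a := j - 2 * l
  have hsplit : ∀ Y : List (A × Bool), Y = Y.take a ++ (Y.drop a).take (j + l - a) ++
      (Y.drop a).drop (j + l - a) := fun Y => by
    rw [List.append_assoc, List.take_append_drop, List.take_append_drop]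
  have htake : ∀ Y : List (A × Bool), Y.length = v.length →
      Y.take a ++ ((Y.drop a).take (j + l - a)).take (j - a) = Y.take j := by
    intro Y hY
    rw [List.take_take, min_eq_left (by omega)]
    conv_rhs => rw [show j = a + (j - a) by omega, List.take_add]
  have key := weight_diff_le (C := 3 * l) (p := (p₁, p₂)) (q := q) T₁.O T₂.O hcard hl hstep
    (ms₁ := (es.drop t).map Prod.fst ++ [T₁.κF q₁])
    (ms₂ := (es.drop t).map Prod.snd ++ [T₂.κF q₂])
    (fun σ hσ => by
      rcases List.mem_append.1 hσ with hσ | hσ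
      · obtain ⟨e, he, rfl⟩ := List.mem_map.1 hσ
        obtain ⟨r, r', hr⟩ := hqq.exists_step he
        exact (hstep r e r' hr).1.1
      · rw [List.mem_singleton.1 hσ]
        exact T₁.copylessF _)
    (fun σ hσ => by
      rcases List.mem_append.1 hσ with hσ | hσ
      · obtain ⟨e, he, rfl⟩ := List.mem_map.1 hσ
        obtain ⟨r, r', hr⟩ := hqq.exists_step he
        exact (hstep r e r' hr).2.1
      · rw [List.mem_singleton.1 hσ]
        exact T₂.copylessF _)
    (fun es' hes' => by
      obtain ⟨u', hu₁, hu₂⟩ := exists_run_of_path (hes'.append hqq)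
      rw [← List.append_assoc, ← List.append_assoc, ← List.map_append, ← List.map_append]
      exact heq u' _ _ ⟨p₁, hp₁, q₁, hq₁, _, hu₁, rfl⟩ ⟨p₂, hp₂, q₂, hq₂, _, hu₂, rfl⟩)
    t (es.take t) (by rw [List.length_take]; omega) hpq
    (Y₁.take a) ((Y₁.drop a).take (j + l - a)) ((Y₁.drop a).drop (j + l - a))
    (Y₂.take a) ((Y₂.drop a).take (j + l - a)) ((Y₂.drop a).drop (j + l - a))
    (hsplit Y₁) (hsplit Y₂) (by simp only [List.length_take, hlY₁, hlY₂])
    (by simp only [List.length_take, List.length_drop, hlY₁, hlY₂])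
    (by simp only [List.length_take, List.length_drop]; omega)
    (by
      refine List.ne_nil_of_length_pos ?_
      simp only [List.length_take, List.length_drop]
      omega)
    (by
      rcases Nat.lt_or_ge j (2 * l) with h | h
      · refine Or.inr (Or.inl ?_)
        have : a = 0 := by omega
        rw [this, List.take_zero]
      rcases Nat.lt_or_ge v.length (j + l) with h' | h'
      · refine Or.inr (Or.inr ?_)
        rw [List.drop_drop]
        exact List.drop_eq_nil_of_le (by omega)
      · left
        rw [List.map_take, List.map_drop, hf₁, show j + l - a = 3 * l by omega]
        exact not_repetitive_of_mem_cuts hj h h')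
    (j - a) (by simp only [List.length_take, List.length_drop]; omega)
  rw [htake _ hlY₁, htake _ hlY₂] at key
  rw [diff]
  omega

end Runs

/-! ### Bounds in terms of the descriptions of the transducers -/

section Code

theorem length_le_encode {α : Type*} [Encodable α] (l : List α) :
    l.length ≤ Encodable.encode l := by
  induction l with
  | nil => exact Nat.zero_le _
  | cons a l ih =>
    rw [Encodable.encode_list_cons, List.length_cons]
    exact Nat.succ_le_succ (ih.trans (Nat.right_le_pair _ _))

theorem encode_le_of_mem {α : Type*} [Encodable α] {l : List α} {a : α} (h : a ∈ l) :
    Encodable.encode a ≤ Encodable.encode l := by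
  induction l with
  | nil => simp at h
  | cons b l ih =>
    rw [Encodable.encode_list_cons]
    rcases List.mem_cons.1 h with rfl | h
    · exact (Nat.left_le_pair _ _).trans (Nat.le_succ _)
    · exact (ih h).trans ((Nat.right_le_pair _ _).trans (Nat.le_succ _))

theorem encode_fst_le {α β : Type*} [Encodable α] [Encodable β] (p : α × β) :
    Encodable.encode p.1 ≤ Encodable.encode p := Nat.left_le_pair _ _

theorem encode_snd_le {α β : Type*} [Encodable α] [Encodable β] (p : α × β) :
    Encodable.encode p.2 ≤ Encodable.encode p := Nat.right_le_pair _ _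

theorem size_le_encode {a x N : ℕ} (σ : Subst (Fin x) (Fin a)) (hx : x ≤ N)
    (h : Encodable.encode σ.code ≤ N) : size σ ≤ N * N := by
  have hi : ∀ i, (σ i).length ≤ N := by
    intro i
    have h₁ : (σ i).map (Sum.map Fin.val Fin.val) ∈ σ.code := List.mem_ofFn.2 ⟨i, rfl⟩
    have h₂ := (length_le_encode _).trans ((encode_le_of_mem h₁).trans h)
    rwa [List.length_map] at h₂
  calc size σ ≤ ∑ _i : Fin x, N := by
        unfold size letterCount
        refine Finset.sum_le_sum fun i _ => ?_
        exact (List.countP_le_length.trans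
          (List.length_filterMap_le Sum.getRight? (σ i))).trans (hi i)
    _ ≤ N * N := by
        rw [Finset.sum_const, Finset.card_univ, Fintype.card_fin, smul_eq_mul]
        exact Nat.mul_le_mul_right _ hx

/-- The numbers of states and variables and the sizes of the substitutions of a transducer are
bounded by its description. -/
theorem bounds_of_code {a n x N : ℕ} (T : SST (Fin a) (Fin n) (Fin x))
    (h : Encodable.encode T.code ≤ N) : n ≤ N ∧ x ≤ N ∧ ∀ e, size (T.κ e) ≤ N * N := by
  have h₁ := (encode_fst_le T.code).trans h
  have h₂ := (encode_snd_le T.code.1).trans h₁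
  have hn : n ≤ N := (encode_fst_le T.code.1.2).trans h₂
  have hx : x ≤ N := (encode_snd_le T.code.1.2).trans h₂
  refine ⟨hn, hx, fun ⟨e, he⟩ => size_le_encode _ hx ?_⟩
  have h₃ := (encode_fst_le T.code.2.2).trans
    ((encode_snd_le T.code.2).trans ((encode_snd_le T.code).trans h))
  have hmem : ((e.1.val, e.2.1.val, e.2.2.val), Subst.code (T.κ ⟨e, he⟩)) ∈ T.code.2.2.1 := by
    refine List.mem_filterMap.2 ⟨e, ?_, by rw [dif_pos he]⟩
    exact List.mem_product.2 ⟨List.mem_finRange _,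
      List.mem_product.2 ⟨List.mem_finRange _, List.mem_finRange _⟩⟩
  exact (encode_snd_le (_, _)).trans ((encode_le_of_mem hmem).trans h₃)

/-- A bound on the number of colors for the Ramsey argument. -/
def colorBound (N : ℕ) : ℕ := N * N * (((N + 1) ^ N) ^ N * ((N + 1) ^ N) ^ N)

/-- The bound `l` on the lengths of the periods. -/
def periodBound (N : ℕ) : ℕ := 2 * (N * N * ramseyBound (colorBound N)) + 1

/-- The bound `k` on the delay. -/
def delayBound (N : ℕ) : ℕ :=
  N * N * ((2 * (3 * periodBound N) + 1) * ramseyBound (colorBound N))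

theorem card_le_colorBound {n₁ x₁ n₂ x₂ N : ℕ} (hn₁ : n₁ ≤ N) (hx₁ : x₁ ≤ N) (hn₂ : n₂ ≤ N)
    (hx₂ : x₂ ≤ N) :
    Fintype.card ((Fin n₁ × Fin n₂) × (Fin x₁ → Fin x₁ → Option (Fin x₁)) ×
      (Fin x₂ → Fin x₂ → Option (Fin x₂))) ≤ colorBound N := by
  have h : ∀ x ≤ N, ((x + 1) ^ x) ^ x ≤ ((N + 1) ^ N) ^ N := fun x hx =>
    (Nat.pow_le_pow_left ((Nat.pow_le_pow_left (Nat.succ_le_succ hx) x).trans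
      (Nat.pow_le_pow_right (Nat.succ_pos N) hx)) x).trans
      (Nat.pow_le_pow_right (pow_pos (Nat.succ_pos N) N) hx)
  simp only [Fintype.card_prod, Fintype.card_fun, Fintype.card_option, Fintype.card_fin]
  exact Nat.mul_le_mul (Nat.mul_le_mul hn₁ hn₂) (Nat.mul_le_mul (h x₁ hx₁) (h x₂ hx₂))

theorem primrec_pow {f g : ℕ → ℕ} (hf : Primrec f) (hg : Primrec g) :
    Primrec fun n => f n ^ g n :=
  Primrec₂.comp (Primrec₂.unpaired'.1 Nat.Primrec.pow) hf hg

theorem primrec_mul {f g : ℕ → ℕ} (hf : Primrec f) (hg : Primrec g) :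
    Primrec fun n => f n * g n :=
  Primrec.nat_mul.comp hf hg

theorem primrec_add {f g : ℕ → ℕ} (hf : Primrec f) (hg : Primrec g) :
    Primrec fun n => f n + g n :=
  Primrec.nat_add.comp hf hg

theorem primrec_ramseyBound_colorBound : Primrec fun N => ramseyBound (colorBound N) := by
  have h : Primrec fun N : ℕ => ((N + 1) ^ N) ^ N :=
    primrec_pow (primrec_pow Primrec.succ Primrec.id) Primrec.id
  have hc : Primrec colorBound :=
    primrec_mul (primrec_mul Primrec.id Primrec.id) (primrec_mul h h)
  exact primrec_pow (primrec_add hc (Primrec.const 1))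
    (primrec_add (primrec_mul (Primrec.const 3) hc) (Primrec.const 1))

theorem primrec_periodBound : Primrec periodBound :=
  primrec_add (primrec_mul (Primrec.const 2) (primrec_mul (primrec_mul Primrec.id Primrec.id)
    primrec_ramseyBound_colorBound)) (Primrec.const 1)

theorem primrec_delayBound : Primrec delayBound :=
  primrec_mul (primrec_mul Primrec.id Primrec.id) (primrec_mul
    (primrec_add (primrec_mul (Primrec.const 2) (primrec_mul (Primrec.const 3)
      primrec_periodBound)) (Primrec.const 1)) primrec_ramseyBound_colorBound)

end Code

/-! ### Inclusion and inclusion with bounded delay -/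

section Inclusion

theorem subset_of_includedUpTo {A Q₁ X₁ Q₂ X₂ : Type*} {T₁ : SST A Q₁ X₁} {T₂ : SST A Q₂ X₂}
    {k l : ℕ} (h : SST.IncludedUpTo k l T₁ T₂) : T₁.rel ⊆ T₂.rel := by
  rintro ⟨u, v⟩ ⟨ls, hls, hv⟩
  obtain ⟨ms, hms, _, _, _, hout, _⟩ := h u ls hls
  exact ⟨ms, hms, hv.trans hout⟩

/-- An inclusion in a functional transducer holds with a delay that is bounded in terms of the
descriptions of both transducers; any run of the second transducer on the same input will do. -/
theorem includedUpTo_of_subset {a n₁ x₁ n₂ x₂ N : ℕ} {T₁ : SST (Fin a) (Fin n₁) (Fin x₁)}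
    {T₂ : SST (Fin a) (Fin n₂) (Fin x₂)} (h₁ : Encodable.encode T₁.code ≤ N)
    (h₂ : Encodable.encode T₂.code ≤ N) (hT₂ : T₂.Functional) (h : T₁.rel ⊆ T₂.rel) :
    SST.IncludedUpTo (delayBound N) (periodBound N) T₁ T₂ := by
  obtain ⟨hn₁, hx₁, hM₁⟩ := bounds_of_code T₁ h₁
  obtain ⟨hn₂, hx₂, hM₂⟩ := bounds_of_code T₂ h₂
  have heq : ∀ u ls ms, (u, ls) ∈ T₁.lang → (u, ms) ∈ T₂.lang → out T₁.O ls = out T₂.O ms :=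
    fun u ls ms hls hms => hT₂ u _ _ (h ⟨ls, hls, rfl⟩) ⟨ms, hms, rfl⟩
  intro u ls hls
  obtain ⟨ms, hms, -⟩ := h (a := (u, out T₁.O ls)) ⟨ls, hls, rfl⟩
  refine ⟨ms, hms, mem_substs_of_mem_lang hls, mem_substs_of_mem_lang hms, ?_,
    heq u ls ms hls hms, ?_⟩
  · rw [length_of_mem_lang hls, length_of_mem_lang hms]
  · exact delay_le (card_le_colorBound hn₁ hx₁ hn₂ hx₂) (Nat.le_succ _) (Nat.succ_pos _) hM₁ hM₂
      heq hls hms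

end Inclusion

end SSTDelay

theorem mainTheorem2 :
    (∃ k l : SSTDelay.SSTCode × SSTDelay.SSTCode → ℕ, Computable k ∧ Computable l ∧
      ∀ (a n₁ x₁ n₂ x₂ : ℕ)
        (T₁ : SSTDelay.SST (Fin a) (Fin n₁) (Fin x₁))
        (T₂ : SSTDelay.SST (Fin a) (Fin n₂) (Fin x₂)),
        T₁.Functional → T₂.Functional →
          0 < l (T₁.code, T₂.code) ∧
          (T₁.rel ⊆ T₂.rel ↔
            SSTDelay.SST.IncludedUpTo
              (k (T₁.code, T₂.code)) (l (T₁.code, T₂.code)) T₁ T₂)) ∧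
    (∃ k l : SSTDelay.SSTCode × SSTDelay.SSTCode → ℕ, Computable k ∧ Computable l ∧
      ∀ (a n₁ x₁ n₂ x₂ : ℕ)
        (T₁ : SSTDelay.SST (Fin a) (Fin n₁) (Fin x₁))
        (T₂ : SSTDelay.SST (Fin a) (Fin n₂) (Fin x₂)),
        T₁.Functional → T₂.Functional →
          0 < l (T₁.code, T₂.code) ∧
          (T₁.rel = T₂.rel ↔
            SSTDelay.SST.EquivUpTo
              (k (T₁.code, T₂.code)) (l (T₁.code, T₂.code)) T₁ T₂)) := by
  have hk : Computable fun c : SSTDelay.SSTCode × SSTDelay.SSTCode =>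
      SSTDelay.delayBound (Encodable.encode c) :=
    SSTDelay.primrec_delayBound.to_comp.comp Computable.encode
  have hl : Computable fun c : SSTDelay.SSTCode × SSTDelay.SSTCode =>
      SSTDelay.periodBound (Encodable.encode c) :=
    SSTDelay.primrec_periodBound.to_comp.comp Computable.encode
  refine ⟨⟨_, _, hk, hl, fun a n₁ x₁ n₂ x₂ T₁ T₂ _ hT₂ => ⟨Nat.succ_pos _, ?_⟩⟩,
    ⟨_, _, hk, hl, fun a n₁ x₁ n₂ x₂ T₁ T₂ hT₁ hT₂ => ⟨Nat.succ_pos _, ?_⟩⟩⟩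
  all_goals
    have h₁ := SSTDelay.encode_fst_le (T₁.code, T₂.code)
    have h₂ := SSTDelay.encode_snd_le (T₁.code, T₂.code)
  · exact ⟨SSTDelay.includedUpTo_of_subset h₁ h₂ hT₂, SSTDelay.subset_of_includedUpTo⟩
  · refine ⟨fun h => ⟨SSTDelay.includedUpTo_of_subset h₁ h₂ hT₂ h.subset,
      SSTDelay.includedUpTo_of_subset h₂ h₁ hT₁ h.superset⟩, fun h => ?_⟩
    exact (SSTDelay.subset_of_includedUpTo h.1).antisymm (SSTDelay.subset_of_includedUpTo h.2)
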